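/- Let $G$ be a finite connected simple graph with vertex set $V$ and edge set $E$, and let $K$ be a field. Let $A_G\in\{0,1\}^{V\times E}$ be the vertex-edge incidence matrix of $G$, let $\pi: K[x_e : e\in E]\to K[t_i : i\in V]$ be the $K$-algebra homomorphism with $\pi(x_{\{i,j\}})=t_it_j$, and let $I_{A_G}=\ker\pi$ be the toric ideal of $A_G$. A binomial is a difference $u-v$ of two distinct monomials, and its support $\mathrm{supp}(u-v)$ is the set of variables that divide $u$ or $v$. A circuit of $I_{A_G}$ is an irreducible binomial $f\in I_{A_G}$ such that there is no binomial $g\in I_{A_G}$ with $\mathrm{supp}(g)\subsetneq\mathrm{supp}(f)$. Let $C$ be the set of circuits of $I_{A_G}$, and let $C^{\mathrm{sf}}$ be the set of circuits $u-v$ such that at least one of the monomials $u,v$ is squarefree. A binomial $f=u-v\in I_{A_G}$ is called - redundant if it belongs to no (inclusion-)minimal system of binomial generators of $I_{A_G}$; - indispensable if every system $F$ of binomial generators of $I_{A_G}$ satisfies $f\in F$ or $-f\in F$; - fundamental if the ideal $I_{A_G}\cap K[x_{\{i,j\}} : \{i,j\}\in E,\ i,j\in T_f]$ of $K[x_{\{i,j\}}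 : \{i,j\}\in E,\ i,j\in T_f]$ is generated by $f$, where $T_f$ is the set of vertices $i$ such that $t_i$ divides $\pi(u)=\pi(v)$. Then the following conditions are equivalent: (i) $I_{A_G}=\langle C^{\mathrm{sf}}\rangle$; (ii) every circuit in $C\setminus C^{\mathrm{sf}}$ is redundant; (iii) every circuit in $C\setminus C^{\mathrm{sf}}$ is not indispensable; (iv) every circuit in $C\setminus C^{\mathrm{sf}}$ is not fundamental; (v) $G$ has no induced subgraph consisting of two odd cycles $C_1,C_2$ without common vertex and a path of length $\ge 2$ which connects a vertex of $C_1$ with a vertex of $C_2$ and meets $C_1$ and $C_2$ only in its end vertices. In particular, if $G$ satisfies the odd cycle condition, i.e., if for any two odd cycles of $G$ without common vertex there is an edge of $G$ joining a vertex of one with a vertex of the other, then $G$ satisfies (v). -/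

import Mathlib

namespace ToricCircuits

open MvPolynomial

noncomputable section

section Toric

variable {ι σ : Type*} [Fintype ι] (K : Type*) [Field K]

/-- The map `π : K[x_j] → K[t_i]`, `x_j ↦ ∏ i, t_i ^ (A i j)`, of a matrix `A` whose columns have
non-negative integer entries (so that the monomials `T ^ a_j` lie in the polynomial ring inside the
Laurent polynomial ring). -/
def toricMap (A : Matrix ι σ ℕ) : MvPolynomial σ K →ₐ[K] MvPolynomial ι K :=
  aeval fun j => ∏ i, (X i : MvPolynomial ι K) ^ A i j

/-- The toric ideal `I_A`, the kernel of `π`. -/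
def toricIdeal (A : Matrix ι σ ℕ) : Ideal (MvPolynomial σ K) :=
  RingHom.ker (toricMap K A)

variable {K}

/-- A binomial is a difference of two distinct monomials. -/
def IsBinomial (f : MvPolynomial σ K) : Prop :=
  ∃ u v : σ →₀ ℕ, u ≠ v ∧ f = monomial u 1 - monomial v 1

variable (K)

/-- The set `C_A` of circuits: irreducible binomials of `I_A` whose support is minimal, with
respect to inclusion, among the supports of the binomials of `I_A`. -/
def circuits (A : Matrix ι σ ℕ) : Set (MvPolynomial σ K) :=
  {f | f ∈ toricIdeal K A ∧ IsBinomial f ∧ Irreducible f ∧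
    ¬ ∃ g ∈ toricIdeal K A, IsBinomial g ∧ g.vars ⊂ f.vars}

/-- The set of circuits `X ^ u - X ^ v` such that `X ^ u` or `X ^ v` is squarefree. -/
def sfCircuits (A : Matrix ι σ ℕ) : Set (MvPolynomial σ K) :=
  {f | f ∈ circuits K A ∧ ∃ u v : σ →₀ ℕ, f = monomial u 1 - monomial v 1 ∧
    (Squarefree (monomial u (1 : K)) ∨ Squarefree (monomial v (1 : K)))}

variable {K}

/-- `F` is a system of binomial generators of `I_A`. -/
def IsBinomialGenerators (A : Matrix ι σ ℕ) (F : Set (MvPolynomial σ K)) : Prop :=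
  (∀ g ∈ F, IsBinomial g) ∧ Ideal.span F = toricIdeal K A

/-- `f` is redundant if it belongs to no (inclusion-)minimal system of binomial generators. -/
def IsRedundant (A : Matrix ι σ ℕ) (f : MvPolynomial σ K) : Prop :=
  ¬ ∃ F : Set (MvPolynomial σ K), Minimal (IsBinomialGenerators A) F ∧ f ∈ F

/-- `f` is indispensable if every system of binomial generators contains `f` or `-f`. -/
def IsIndispensable (A : Matrix ι σ ℕ) (f : MvPolynomial σ K) : Prop :=
  f ∈ toricIdeal K A ∧ IsBinomial f ∧
    ∀ F : Set (MvPolynomial σ K), IsBinomialGenerators A F → f ∈ F ∨ -f ∈ F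

variable (K)

/-- The set of (indices `i` of) variables `t_i` dividing `π (X ^ u)`. -/
def dividingVars (A : Matrix ι σ ℕ) (u : σ →₀ ℕ) : Set ι :=
  {i | (X i : MvPolynomial ι K) ∣ toricMap K A (monomial u 1)}

/-- The (indices of) columns `a_j` of `A` with `T ^ a_j ∈ K[t_i : i ∈ T]`. -/
def columnsIn (A : Matrix ι σ ℕ) (T : Set ι) : Set σ :=
  {j | toricMap K A (X j) ∈ supported K T}

variable {K}

/-- `f = X ^ u - X ^ v ∈ I_A` is fundamental if `I_{A_f} = (f)`, where `A_f` consists of the columns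
`a_j` of `A` such that `T ^ a_j` only involves the variables dividing `π (X ^ u) = π (X ^ v)`, and
where `f` is regarded as a polynomial `g` in the variables `x_j` indexed by these columns. -/
def IsFundamental (A : Matrix ι σ ℕ) (f : MvPolynomial σ K) : Prop :=
  f ∈ toricIdeal K A ∧ ∃ u v : σ →₀ ℕ, u ≠ v ∧ f = monomial u 1 - monomial v 1 ∧
    ∃ g : MvPolynomial (columnsIn K A (dividingVars K A u)) K,
      rename Subtype.val g = f ∧
      toricIdeal K (A.submatrix id
        (Subtype.val : columnsIn K A (dividingVars K A u) → σ)) = Ideal.span {g}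

end Toric

section Graph

variable {V : Type*}

/-- The vertex-edge incidence matrix `A_G`: the column of an edge `{i, j}` is `e_i + e_j`. -/
def edgeMatrix (G : SimpleGraph V) : Matrix V G.edgeSet ℕ :=
  open Classical in Matrix.of fun v e => if v ∈ (e : Sym2 V) then 1 else 0

/-- `c` is a cycle of odd length. -/
def IsOddCycle {G : SimpleGraph V} {a : V} (c : G.Walk a a) : Prop :=
  c.IsCycle ∧ Odd c.length

/-- `G` has an induced subgraph consisting of two odd cycles `c₁`, `c₂` without common vertex and a
path `p` of length at least `2` from a vertex `a` of `c₁` to a vertex `b` of `c₂`, which meets the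
two cycles in its end points only. -/
def HasInducedLongDumbbell (G : SimpleGraph V) : Prop :=
  ∃ (a b : V) (c₁ : G.Walk a a) (c₂ : G.Walk b b) (p : G.Walk a b),
    IsOddCycle c₁ ∧ IsOddCycle c₂ ∧ p.IsPath ∧ 2 ≤ p.length ∧
    (∀ x, x ∈ c₁.support → x ∉ c₂.support) ∧
    (∀ x ∈ p.support, x ∈ c₁.support → x = a) ∧
    (∀ x ∈ p.support, x ∈ c₂.support → x = b) ∧
    (c₁.toSubgraph ⊔ p.toSubgraph ⊔ c₂.toSubgraph).IsInduced

/-- The odd cycle condition: any two odd cycles without common vertex are joined by an edge. -/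
def OddCycleCondition (G : SimpleGraph V) : Prop :=
  ∀ (a b : V) (c₁ : G.Walk a a) (c₂ : G.Walk b b), IsOddCycle c₁ → IsOddCycle c₂ →
    (∀ x, x ∈ c₁.support → x ∉ c₂.support) →
    ∃ x ∈ c₁.support, ∃ y ∈ c₂.support, G.Adj x y

end Graph

end

end ToricCircuits

/-! A dumbbell means two odd cycles joined by a path. Walking around it, and twice along the path,
gives an even closed walk whose odd-position and even-position edges form two monomials of equal
multidegree. Integer vectors in the kernel of `edgeMatrix G` supported on a dumbbell, or on an even
cycle, are multiples of a single vector (`GeneratesKernelOn`), so the binomial of the walk is a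
circuit. If the path has length at least 2, each monomial contains the square of a path edge; if the
dumbbell is moreover induced, no other columns enter `IsFundamental`, so the circuit is fundamental.
This proves (iv) → (v) by contraposition. A fundamental binomial is indispensable because the ideal
is graded, and an indispensable one lies in a minimal generating system; hence (ii) → (iii) → (iv).
Also (i) → (iii), since the squarefree circuits are then a generating system.

The substance is (v) → (i) and (v) → (ii). Both follow from one statement about an additive
congruence `c` on exponent vectors (`RelatesBelow.rel_or_mem_sfCircuits`): if `c` relates all pairs
of equal multidegree in degree below `d`, then in degree `d` a pair is related or its binomial is a
squarefree circuit. For (i), `c` comes from the ideal of squarefree circuits and one inducts on `d`;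
for (ii), `c` comes from the ideal of binomials of lower degree.

To prove the statement, an unrelated pair is written as an even closed walk. Any shortcut splitting
the walk into shorter even closed walks would relate the pair through lower degrees. If the binomial
is not a squarefree circuit, the walk must contain two odd cycles whose vertices are separated from
the rest. Minimal lollipops inside the walk then yield an induced dumbbell with a long path, which
(v) forbids. -/

namespace ToricCircuits

open MvPolynomial

noncomputable section

/-! ### Toric ideals, binomials, and kernels of rank one -/

section ToricLemmas

variable {ι σ : Type*} [Fintype ι] {K : Type*} [Field K]

/-- The exponent vector `A u`, so that `π (X ^ u) = T ^ (A u)`. -/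
def multidegree (A : Matrix ι σ ℕ) : (σ →₀ ℕ) →+ (ι →₀ ℕ) :=
  Finsupp.weight fun j => Finsupp.equivFunOnFinite.symm fun i => A i j

theorem multidegree_single (A : Matrix ι σ ℕ) (j : σ) (n : ℕ) (i : ι) :
    multidegree A (Finsupp.single j n) i = n * A i j := by
  simp [multidegree, Finsupp.weight_single]

theorem multidegree_apply (A : Matrix ι σ ℕ) (u : σ →₀ ℕ) (i : ι) :
    multidegree A u i = u.sum fun j n => n * A i j := by
  induction u using Finsupp.induction_linear with
  | zero => simp
  | add f g hf hg =>
    rw [map_add, Finsupp.add_apply, hf, hg, Finsupp.sum_add_index']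
    · simp
    · intros; ring
  | single j n => rw [multidegree_single, Finsupp.sum_single_index (by simp)]

theorem toricMap_monomial (A : Matrix ι σ ℕ) (u : σ →₀ ℕ) :
    toricMap K A (monomial u 1) = monomial (multidegree A u) 1 := by
  induction u using Finsupp.induction_linear with
  | zero => simp [← C_apply]
  | add f g hf hg =>
    rw [map_add, ← one_mul (1 : K), ← monomial_mul, ← monomial_mul, map_mul, hf, hg]
  | single j n =>
    rw [← X_pow_eq_monomial, map_pow, toricMap, aeval_X, ← Finset.prod_pow, monomial_eq]
    rw [Finsupp.prod_fintype _ _ (by simp)]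
    simp only [map_one, one_mul, multidegree_single]
    exact Finset.prod_congr rfl fun i _ => by rw [← pow_mul, mul_comm]

theorem binomial_mem_toricIdeal_iff {A : Matrix ι σ ℕ} {u v : σ →₀ ℕ} :
    monomial u (1 : K) - monomial v 1 ∈ toricIdeal K A ↔ multidegree A u = multidegree A v := by
  rw [toricIdeal, RingHom.mem_ker, map_sub, sub_eq_zero]
  erw [toricMap_monomial, toricMap_monomial]
  exact ⟨fun h => (monomial_left_injective one_ne_zero) h, fun h => by rw [h]⟩

theorem toricIdeal_isPrime (A : Matrix ι σ ℕ) : (toricIdeal K A).IsPrime :=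
  RingHom.ker_isPrime _

/-- The images of the terms of `p` cancel, so every exponent of `p` shares its multidegree with
another one; subtracting a multiple of their binomial shrinks the support. Only exponents of `p`
occur, which lets the lemma be applied to polynomials in a prescribed set of variables. -/
theorem mem_of_binomials_mem {A : Matrix ι σ ℕ} {J : Ideal (MvPolynomial σ K)} :
    ∀ (n : ℕ) (p : MvPolynomial σ K), p.support.card = n → p ∈ toricIdeal K A →
      (∀ u ∈ p.support, ∀ v ∈ p.support, multidegree A u = multidegree A v →
        monomial u 1 - monomial v 1 ∈ J) → p ∈ J := by
  intro n
  induction n using Nat.strong_induction_on with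
  | _ n ih =>
  classical
  intro p hn hp hJ
  by_cases h0 : p = 0
  · simp [h0]
  obtain ⟨u, hu⟩ := (Finset.nonempty_iff_ne_empty.2 (mt support_eq_empty.1 h0))
  obtain ⟨v, hv, hvu, huv⟩ : ∃ v ∈ p.support, v ≠ u ∧ multidegree A u = multidegree A v := by
    by_contra! hcon
    have h1 : toricMap K A p = 0 := hp
    have h2 : coeff (multidegree A u) (toricMap K A p) = coeff u p := by
      conv_lhs => rw [p.as_sum]
      rw [map_sum, coeff_sum, Finset.sum_eq_single u]
      · rw [← mul_one (coeff u p), ← smul_eq_mul, ← smul_monomial, map_smul, toricMap_monomial,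
          coeff_smul, coeff_monomial, if_pos rfl]
      · intro v hv hvu
        rw [← mul_one (coeff v p), ← smul_eq_mul, ← smul_monomial, map_smul, toricMap_monomial,
          coeff_smul, coeff_monomial, if_neg (fun h => hcon v hv hvu h.symm)]
        simp
      · intro h; exact absurd hu h
    rw [h1, coeff_zero] at h2
    exact (mem_support_iff.1 hu) h2.symm
  set q := p - C (coeff u p) * (monomial u 1 - monomial v 1) with hq
  have hb := hJ u hu v hv huv
  have hcoeff : ∀ w, coeff w q = coeff w p - coeff u p *
      ((if u = w then 1 else 0) - (if v = w then 1 else 0)) := by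
    intro w
    rw [hq, coeff_sub, coeff_C_mul, coeff_sub, coeff_monomial, coeff_monomial]
  have hsub : q.support ⊂ p.support := by
    refine (Finset.ssubset_iff_of_subset ?_).2 ⟨u, hu, ?_⟩
    · intro w hw
      rw [mem_support_iff, hcoeff] at hw
      by_contra hwp
      have h1 : u ≠ w := fun h => hwp (h ▸ hu)
      have h2 : v ≠ w := fun h => hwp (h ▸ hv)
      rw [notMem_support_iff] at hwp
      simp [hwp, h1, h2] at hw
    · rw [notMem_support_iff, hcoeff]
      simp [hvu]
  have hqJ : q ∈ J := by
    refine ih _ (hn ▸ Finset.card_lt_card hsub) q rfl ?_ ?_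
    · exact sub_mem hp (Ideal.mul_mem_left _ _ (binomial_mem_toricIdeal_iff.2 huv))
    · exact fun a ha b hb => hJ a (hsub.1 ha) b (hsub.1 hb)
  have : p = q + C (coeff u p) * (monomial u 1 - monomial v 1) := by rw [hq]; ring
  rw [this]
  exact add_mem hqJ (Ideal.mul_mem_left _ _ hb)

theorem toricIdeal_le_of_binomials_mem {A : Matrix ι σ ℕ} {J : Ideal (MvPolynomial σ K)}
    (h : ∀ u v, multidegree A u = multidegree A v → monomial u 1 - monomial v 1 ∈ J) :
    toricIdeal K A ≤ J :=
  fun p hp => mem_of_binomials_mem _ p rfl hp fun u _ v _ => h u v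

theorem support_binomial {u v : σ →₀ ℕ} (h : u ≠ v) [DecidableEq (σ →₀ ℕ)] :
    (monomial u (1 : K) - monomial v 1).support = {u, v} := by
  classical
  ext w
  rw [mem_support_iff, coeff_sub, coeff_monomial, coeff_monomial]
  by_cases h1 : u = w
  · subst h1; simp [h.symm]
  · by_cases h2 : v = w
    · subst h2; simp [h1]
    · simp [h1, h2, Ne.symm h1, Ne.symm h2]

theorem mem_vars_binomial {u v : σ →₀ ℕ} (h : u ≠ v) {j : σ} :
    j ∈ (monomial u (1 : K) - monomial v 1).vars ↔ u j ≠ 0 ∨ v j ≠ 0 := by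
  classical
  rw [mem_vars_iff_mem_support, support_binomial h]
  simp

theorem squarefree_monomial {u : σ →₀ ℕ} (h : ∀ j, u j ≤ 1) :
    Squarefree (monomial u (1 : K)) := by
  classical
  rintro q ⟨r, hr⟩
  have hne : monomial u (1 : K) ≠ 0 := by simp
  rw [hr] at hne
  have hq : q ≠ 0 := fun h => hne (by simp [h])
  have hr0 : r ≠ 0 := fun h => hne (by simp [h])
  have hdeg : ∀ j, degreeOf j q = 0 := by
    intro j
    have h1 : degreeOf j (monomial u (1 : K)) ≤ 1 := by
      rw [degreeOf_monomial_eq _ _ one_ne_zero]; exact h j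
    rw [hr, degreeOf_mul_eq (mul_ne_zero hq hq) hr0, degreeOf_mul_eq hq hq] at h1
    omega
  have h2 : q.vars = ∅ := by
    ext j
    simp [mem_vars_iff_degreeOf_ne_zero, hdeg]
  rw [vars_eq_empty_iff_eq_C] at h2
  have hc : q.coeff 0 ≠ 0 := fun h0 => hq (by rw [h2, h0, C_0])
  rw [h2]
  exact hc.isUnit.map C

theorem not_squarefree_monomial {u : σ →₀ ℕ} {j : σ} (h : 2 ≤ u j) :
    ¬ Squarefree (monomial u (1 : K)) := by
  intro hs
  have : X j * X j ∣ monomial u (1 : K) := by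
    rw [X, monomial_mul, monomial_dvd_monomial]
    refine ⟨Or.inr ?_, by simp⟩
    rw [← Finsupp.single_add, Finsupp.single_le_iff]
    exact h
  exact (X_prime (R := K) (i := j)).not_isUnit (hs _ this)

/-- The integer vectors in the kernel of `A` which are supported in `S` are the multiples of the
vector `u - v`, where `u` and `v` have disjoint supports contained in `S`. -/
structure GeneratesKernelOn (A : Matrix ι σ ℕ) (S : Set σ) (u v : σ →₀ ℕ) : Prop where
  ne : u ≠ v
  multidegree_eq : multidegree A u = multidegree A v
  disjoint : ∀ j, u j = 0 ∨ v j = 0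
  support : ∀ j, u j ≠ 0 ∨ v j ≠ 0 → j ∈ S
  kernel : ∀ a b : σ →₀ ℕ, (∀ j ∉ S, a j = 0 ∧ b j = 0) → multidegree A a = multidegree A b →
    ∃ k : ℤ, ∀ j, (a j : ℤ) - b j = k * (u j - v j)

variable {A : Matrix ι σ ℕ} {S : Set σ} {u v : σ →₀ ℕ}

/-- Disjointness of supports gives `n • u ≤ a`, so the binomial is a monomial times a difference of
`n`-th powers. -/
theorem binomial_dvd_of_sub_eq_mul (hd : ∀ j, u j = 0 ∨ v j = 0) {a b : σ →₀ ℕ} {n : ℕ}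
    (h : ∀ j, (a j : ℤ) - b j = n * (u j - v j)) :
    monomial u (1 : K) - monomial v 1 ∣ monomial a 1 - monomial b 1 := by
  have hle : n • u ≤ a := by
    intro j
    have := h j
    rcases hd j with h0 | h0
    · simp [h0]
    · rw [h0] at this
      simp only [Finsupp.coe_smul, Pi.smul_apply, smul_eq_mul]
      push_cast at this
      zify
      linarith
  obtain ⟨m, rfl⟩ := exists_add_of_le hle
  have hb : b = n • v + m := by
    ext j
    have := h j
    simp only [Finsupp.coe_add, Finsupp.coe_smul, Pi.add_apply, Pi.smul_apply, smul_eq_mul] at this ⊢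
    push_cast at this
    zify
    linarith
  subst hb
  have hm : ∀ w : σ →₀ ℕ, monomial (n • w + m) (1 : K) = monomial w 1 ^ n * monomial m 1 := by
    intro w
    rw [monomial_pow, monomial_mul]
    simp
  rw [hm, hm, ← sub_mul]
  exact (sub_dvd_pow_sub_pow _ _ n).mul_right _

theorem GeneratesKernelOn.dvd (h : GeneratesKernelOn A S u v) {p : MvPolynomial σ K}
    (hp : p ∈ toricIdeal K A) (hS : ∀ j ∈ p.vars, j ∈ S) :
    monomial u (1 : K) - monomial v 1 ∣ p := by
  rw [← Ideal.mem_span_singleton]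
  refine mem_of_binomials_mem _ p rfl hp fun a ha b hb hab => Ideal.mem_span_singleton.2 ?_
  obtain ⟨k, hk⟩ := h.kernel a b (fun j hj => by
    have hj' : j ∉ p.vars := fun h' => hj (hS j h')
    simp only [mem_vars_iff_mem_support, not_exists, not_and, Finsupp.mem_support_iff, not_not] at hj'
    exact ⟨hj' a ha, hj' b hb⟩) hab
  obtain ⟨n, rfl | rfl⟩ := k.eq_nat_or_neg
  · exact binomial_dvd_of_sub_eq_mul h.disjoint hk
  · rw [dvd_sub_comm]
    refine binomial_dvd_of_sub_eq_mul (n := n) h.disjoint fun j => ?_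
    have := hk j
    linarith

theorem GeneratesKernelOn.mem_toricIdeal (h : GeneratesKernelOn A S u v) :
    monomial u (1 : K) - monomial v 1 ∈ toricIdeal K A :=
  binomial_mem_toricIdeal_iff.2 h.multidegree_eq

theorem binomial_ne_zero (h : u ≠ v) : monomial u (1 : K) - monomial v 1 ≠ 0 :=
  sub_ne_zero.2 fun h' => h (monomial_left_injective one_ne_zero h')

/-- The toric ideal is prime, so one factor lies in it. Its variables are in `S`, hence it is
divisible by the binomial and the other factor is a unit. -/
theorem GeneratesKernelOn.irreducible (h : GeneratesKernelOn A S u v) :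
    Irreducible (monomial u (1 : K) - monomial v 1) := by
  classical
  have hI := toricIdeal_isPrime (K := K) A
  have hne := binomial_ne_zero (K := K) h.ne
  have key : ∀ p q : MvPolynomial σ K, monomial u (1 : K) - monomial v 1 = p * q →
      p ∈ toricIdeal K A → IsUnit q := by
    intro p q hpq hp
    have hpq0 := hne
    rw [hpq] at hpq0
    have hp0 := left_ne_zero_of_mul hpq0
    obtain ⟨r, hr⟩ := h.dvd hp fun j hj => h.support j <| by
      rw [← mem_vars_binomial (K := K) h.ne, hpq, mem_vars_iff_degreeOf_ne_zero,
        degreeOf_mul_eq hp0 (right_ne_zero_of_mul hpq0)]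
      have := mem_vars_iff_degreeOf_ne_zero.1 hj
      omega
    rw [hr, mul_assoc] at hpq
    have := mul_left_cancel₀ hne ((mul_one _).trans hpq)
    exact IsUnit.of_mul_eq_one r (by rw [mul_comm, ← this])
  refine ⟨fun hu => hI.ne_top ?_, fun p q hpq => ?_⟩
  · exact Ideal.eq_top_of_isUnit_mem _ h.mem_toricIdeal hu
  · have hmem : p * q ∈ toricIdeal K A := hpq ▸ h.mem_toricIdeal
    rcases hI.mem_or_mem hmem with hp | hq
    · exact Or.inr (key p q hpq hp)
    · exact Or.inl (key q p (hpq.trans (mul_comm _ _)) hq)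

/-- A binomial of the ideal supported in `S` has exponent difference `k * (u - v)` with `k ≠ 0`, so
it involves every variable of `u` and `v`. -/
theorem GeneratesKernelOn.mem_circuits (h : GeneratesKernelOn A S u v) :
    monomial u (1 : K) - monomial v 1 ∈ circuits K A := by
  refine ⟨h.mem_toricIdeal, ⟨u, v, h.ne, rfl⟩, h.irreducible, ?_⟩
  rintro ⟨g, hg, ⟨a, b, hab, rfl⟩, hss⟩
  obtain ⟨k, hk⟩ := h.kernel a b (fun j hj => by
    have : j ∉ (monomial a (1 : K) - monomial b 1).vars := fun h' =>
      hj (h.support j ((mem_vars_binomial h.ne).1 (hss.1 h')))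
    rw [mem_vars_binomial hab] at this
    omega) (binomial_mem_toricIdeal_iff.1 hg)
  have hk0 : k ≠ 0 := by
    rintro rfl
    exact hab (Finsupp.ext fun j => by have := hk j; omega)
  refine hss.2 fun j hj => ?_
  rw [mem_vars_binomial h.ne] at hj
  rw [mem_vars_binomial hab]
  by_contra! hcon
  have h1 := hk j
  rw [hcon.1, hcon.2] at h1
  have h2 : (u j : ℤ) - v j = 0 := by
    rcases mul_eq_zero.1 (h1.symm.trans (by simp)) with h' | h'
    · exact absurd h' hk0
    · exact h'
  rcases h.disjoint j with h' | h' <;> omega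

theorem binomial_eq_binomial {a b : σ →₀ ℕ} (h : u ≠ v)
    (he : monomial a (1 : K) - monomial b 1 = monomial u 1 - monomial v 1) :
    (a = u ∧ b = v) ∨ (a = v ∧ b = u) := by
  classical
  have hab : a ≠ b := by
    rintro rfl
    rw [sub_self] at he
    exact binomial_ne_zero h he.symm
  have h1 := congrArg MvPolynomial.support he
  rw [support_binomial h, support_binomial hab] at h1
  have ha : a ∈ ({u, v} : Finset _) := h1 ▸ by simp
  have hb : b ∈ ({u, v} : Finset _) := h1 ▸ by simp
  simp only [Finset.mem_insert, Finset.mem_singleton] at ha hb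
  grind

theorem notMem_sfCircuits {i j : σ} (h : u ≠ v) (hi : 2 ≤ u i) (hj : 2 ≤ v j) :
    monomial u (1 : K) - monomial v 1 ∉ sfCircuits K A := by
  rintro ⟨-, a, b, he, hs⟩
  rcases binomial_eq_binomial h he.symm with ⟨rfl, rfl⟩ | ⟨rfl, rfl⟩
  · exact hs.elim (not_squarefree_monomial hi) (not_squarefree_monomial hj)
  · exact hs.elim (not_squarefree_monomial hj) (not_squarefree_monomial hi)

theorem neg_mem_circuits {f : MvPolynomial σ K} (h : f ∈ circuits K A) : -f ∈ circuits K A := by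
  obtain ⟨h1, ⟨u, v, huv, rfl⟩, h3, h4⟩ := h
  refine ⟨neg_mem h1, ⟨v, u, huv.symm, by ring⟩, (Associated.refl _).neg_left.irreducible_iff.2 h3, ?_⟩
  rwa [vars_neg]

theorem neg_mem_sfCircuits {f : MvPolynomial σ K} (h : f ∈ sfCircuits K A) :
    -f ∈ sfCircuits K A := by
  obtain ⟨h1, u, v, rfl, h2⟩ := h
  exact ⟨neg_mem_circuits h1, v, u, by ring, h2.symm⟩

end ToricLemmas

end

end ToricCircuits

namespace ToricCircuits

open MvPolynomial

noncomputable section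

/-! ### Generating systems: fundamental, indispensable and redundant binomials -/

section Systems

variable {ι σ : Type*} [Fintype ι] {K : Type*} [Field K]
variable {A : Matrix ι σ ℕ} {S : Set σ} {u v : σ →₀ ℕ}

theorem mem_dividingVars {i : ι} : i ∈ dividingVars K A u ↔ multidegree A u i ≠ 0 := by
  simp [dividingVars, toricMap_monomial, X_dvd_monomial]

theorem mem_columnsIn {T : Set ι} {j : σ} : j ∈ columnsIn K A T ↔ ∀ i, A i j ≠ 0 → i ∈ T := by
  rw [columnsIn, Set.mem_ofPred_eq, X, toricMap_monomial, mem_supported,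
    vars_monomial one_ne_zero]
  simp [Set.subset_def, multidegree_single]

theorem multidegree_ne_zero {i : ι} {j : σ} (hu : u j ≠ 0) (hA : A i j ≠ 0) :
    multidegree A u i ≠ 0 := by
  rw [multidegree_apply, Finsupp.sum]
  intro h
  have := Finset.sum_eq_zero_iff.1 h j (Finsupp.mem_support_iff.2 hu)
  simp_all

theorem mem_columnsIn_of_ne_zero {j : σ} (h : u j ≠ 0) :
    j ∈ columnsIn K A (dividingVars K A u) :=
  mem_columnsIn.2 fun _ hi => mem_dividingVars.2 (multidegree_ne_zero h hi)

theorem dividingVars_mono {a : σ →₀ ℕ} (h : a ≤ u) : dividingVars K A a ⊆ dividingVars K A u := by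
  intro i hi
  rw [mem_dividingVars] at hi ⊢
  obtain ⟨c, rfl⟩ := exists_add_of_le h
  rw [map_add, Finsupp.add_apply]
  omega

theorem columnsIn_mono {T T' : Set ι} (h : T ⊆ T') : columnsIn K A T ⊆ columnsIn K A T' :=
  fun _ hj => mem_columnsIn.2 fun i hi => h (mem_columnsIn.1 hj i hi)

theorem dividingVars_congr {a b : σ →₀ ℕ} (h : multidegree A a = multidegree A b) :
    dividingVars K A a = dividingVars K A b := by
  ext i; rw [mem_dividingVars, mem_dividingVars, h]

theorem multidegree_submatrix {C : Set σ} (a : C →₀ ℕ) :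
    multidegree (A.submatrix id (Subtype.val : C → σ)) a =
      multidegree A (a.mapDomain Subtype.val) := by
  ext i
  induction a using Finsupp.induction_linear with
  | zero => simp
  | add f g hf hg => simp only [map_add, Finsupp.add_apply, hf, hg, Finsupp.mapDomain_add]
  | single j n => simp [Finsupp.mapDomain_single, multidegree_single]

theorem mapDomain_comapDomain_val {C : Set σ} {a : σ →₀ ℕ} (h : ∀ j, a j ≠ 0 → j ∈ C) :
    (a.comapDomain (Subtype.val : C → σ) Subtype.val_injective.injOn).mapDomain Subtype.val = a :=
  Finsupp.mapDomain_comapDomain _ Subtype.val_injective _ fun j hj => by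
    simpa using h j (Finsupp.mem_support_iff.1 hj)

theorem rename_comapDomain {C : Set σ} {a b : σ →₀ ℕ} (ha : ∀ j, a j ≠ 0 → j ∈ C)
    (hb : ∀ j, b j ≠ 0 → j ∈ C) :
    rename Subtype.val (monomial (a.comapDomain (Subtype.val : C → σ)
      Subtype.val_injective.injOn) (1 : K) - monomial (b.comapDomain (Subtype.val : C → σ)
      Subtype.val_injective.injOn) 1) = monomial a 1 - monomial b 1 := by
  rw [map_sub, rename_monomial, rename_monomial, mapDomain_comapDomain_val ha,
    mapDomain_comapDomain_val hb]

theorem GeneratesKernelOn.isFundamental (h : GeneratesKernelOn A S u v)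
    (hS : columnsIn K A (dividingVars K A u) ⊆ S) :
    IsFundamental A (monomial u (1 : K) - monomial v 1) := by
  set C := columnsIn K A (dividingVars K A u) with hC
  have hu : ∀ j, u j ≠ 0 → j ∈ C := fun j hj => mem_columnsIn_of_ne_zero hj
  have hv : ∀ j, v j ≠ 0 → j ∈ C := fun j hj => by
    rw [hC, dividingVars_congr h.multidegree_eq]
    exact mem_columnsIn_of_ne_zero hj
  refine ⟨h.mem_toricIdeal, u, v, h.ne, rfl, _, rename_comapDomain hu hv, ?_⟩
  have hk : GeneratesKernelOn (A.submatrix id (Subtype.val : C → σ)) Set.univ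
      (u.comapDomain (Subtype.val : C → σ) Subtype.val_injective.injOn)
      (v.comapDomain (Subtype.val : C → σ) Subtype.val_injective.injOn) := by
    refine ⟨fun he => h.ne ?_, ?_, fun j => h.disjoint j, fun _ _ => Set.mem_univ _, ?_⟩
    · rw [← mapDomain_comapDomain_val hu, he, mapDomain_comapDomain_val hv]
    · rw [multidegree_submatrix, multidegree_submatrix, mapDomain_comapDomain_val hu,
        mapDomain_comapDomain_val hv, h.multidegree_eq]
    · intro a b _ hab
      rw [multidegree_submatrix, multidegree_submatrix] at hab
      have h0 : ∀ c : C →₀ ℕ, ∀ j ∉ S, c.mapDomain Subtype.val j = 0 := fun c j hj =>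
        Finsupp.mapDomain_of_notMem_range _ _ fun ⟨x, hx⟩ => hj (hS (hx ▸ x.2))
      obtain ⟨k, hk⟩ := h.kernel _ _ (fun j hj => ⟨h0 a j hj, h0 b j hj⟩) hab
      refine ⟨k, fun j => ?_⟩
      have := hk j
      rwa [Finsupp.mapDomain_apply Subtype.val_injective,
        Finsupp.mapDomain_apply Subtype.val_injective] at this
  refine le_antisymm (fun p hp => Ideal.mem_span_singleton.2 (hk.dvd hp fun _ _ => Set.mem_univ _))
    ?_
  rw [Ideal.span_singleton_le_iff_mem]
  exact hk.mem_toricIdeal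

/-- The toric ideal is homogeneous with respect to the standard grading. -/
def IsGraded (A : Matrix ι σ ℕ) : Prop :=
  ∀ u v : σ →₀ ℕ, multidegree A u = multidegree A v → u.degree = v.degree

theorem isHomogeneous_binomial {n : ℕ} (hu : u.degree = n) (hv : v.degree = n) :
    (monomial u (1 : K) - monomial v 1).IsHomogeneous n :=
  (isHomogeneous_monomial _ hu).sub (isHomogeneous_monomial _ hv)

/-- The span is contained in the monomial ideal generated by all monomials of members of `F`. -/
theorem exists_le_of_mem_span {F : Set (MvPolynomial σ K)} {p : MvPolynomial σ K}
    (hp : p ∈ Ideal.span F) (hu : u ∈ p.support) : ∃ g ∈ F, ∃ a ∈ g.support, a ≤ u := by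
  have hle : Ideal.span F ≤
      Ideal.span ((fun a => monomial a (1 : K)) '' {a | ∃ g ∈ F, a ∈ g.support}) :=
    Ideal.span_le.2 fun g hg => mem_ideal_span_monomial_image.2 fun a ha => ⟨a, ⟨g, hg, ha⟩, le_rfl⟩
  obtain ⟨a, ⟨g, hg, ha⟩, hau⟩ := mem_ideal_span_monomial_image.1 (hle hp) u hu
  exact ⟨g, hg, a, ha, hau⟩

theorem exists_binomial_of_mem_support {g : MvPolynomial σ K} (hg : IsBinomial g) {a : σ →₀ ℕ}
    (ha : a ∈ g.support) : ∃ b, a ≠ b ∧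
      (g = monomial a 1 - monomial b 1 ∨ g = -(monomial a 1 - monomial b 1)) := by
  classical
  obtain ⟨c, d, hcd, rfl⟩ := hg
  rw [support_binomial hcd, Finset.mem_insert, Finset.mem_singleton] at ha
  rcases ha with rfl | rfl
  · exact ⟨d, hcd, Or.inl rfl⟩
  · exact ⟨c, hcd.symm, Or.inr (by ring)⟩

/-- Some member of `F` has, up to sign, the form `X ^ a - X ^ b` with `a ≤ u`. It only involves
columns in the range of `f`, so `f` divides it. By homogeneity its degree is at most that of `f`, so
the quotient is constant and equals 1. -/
theorem IsFundamental.isIndispensable (hA : IsGraded A) {f : MvPolynomial σ K}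
    (h : IsFundamental A f) : IsIndispensable A f := by
  classical
  obtain ⟨hf, u, v, huv, rfl, g, hg, hI⟩ := h
  refine ⟨hf, ⟨u, v, huv, rfl⟩, fun F hF => ?_⟩
  have huf : u ∈ (monomial u (1 : K) - monomial v 1).support := by simp [support_binomial huv]
  obtain ⟨q, hq, a, ha, hau⟩ := exists_le_of_mem_span (hF.2.symm ▸ hf) huf
  obtain ⟨b, hab, hqab⟩ := exists_binomial_of_mem_support (hF.1 q hq) ha
  have hqI : q ∈ toricIdeal K A := hF.2 ▸ Ideal.subset_span hq
  have hb : monomial a (1 : K) - monomial b 1 ∈ toricIdeal K A := by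
    rcases hqab with rfl | rfl
    · exact hqI
    · exact neg_mem_iff.1 hqI
  suffices he : monomial a (1 : K) - monomial b 1 = monomial u 1 - monomial v 1 by
    rw [he] at hqab
    rcases hqab with rfl | rfl
    · exact Or.inl hq
    · exact Or.inr hq
  rw [binomial_mem_toricIdeal_iff] at hb hf
  have hsub := dividingVars_mono (K := K) (A := A) hau
  have haC : ∀ j, a j ≠ 0 → j ∈ columnsIn K A (dividingVars K A u) := fun j hj =>
    columnsIn_mono hsub (mem_columnsIn_of_ne_zero hj)
  have hbC : ∀ j, b j ≠ 0 → j ∈ columnsIn K A (dividingVars K A u) := fun j hj => by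
    refine columnsIn_mono hsub ?_
    rw [dividingVars_congr hb]
    exact mem_columnsIn_of_ne_zero hj
  have hmem := (binomial_mem_toricIdeal_iff (K := K)).2
    (show multidegree (A.submatrix id Subtype.val) (a.comapDomain (Subtype.val :
      columnsIn K A (dividingVars K A u) → σ) Subtype.val_injective.injOn) =
      multidegree (A.submatrix id Subtype.val) (b.comapDomain (Subtype.val :
      columnsIn K A (dividingVars K A u) → σ) Subtype.val_injective.injOn) by
    rw [multidegree_submatrix, multidegree_submatrix, mapDomain_comapDomain_val haC,
      mapDomain_comapDomain_val hbC, hb])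
  rw [hI, Ideal.mem_span_singleton] at hmem
  obtain ⟨r, hr⟩ := hmem
  have hr' := congrArg (rename Subtype.val) hr
  rw [rename_comapDomain haC hbC, map_mul, hg] at hr'
  set r' := rename Subtype.val r
  have hr0 : r' ≠ 0 := fun h0 => binomial_ne_zero (K := K) hab (by rw [hr', h0, mul_zero])
  have hdeg := congrArg totalDegree hr'
  rw [totalDegree_mul_of_isDomain (binomial_ne_zero huv) hr0,
    (isHomogeneous_binomial rfl (hA _ _ hb).symm).totalDegree (binomial_ne_zero hab),
    (isHomogeneous_binomial rfl (hA _ _ hf).symm).totalDegree (binomial_ne_zero huv)] at hdeg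
  obtain ⟨c, rfl⟩ := exists_add_of_le hau
  rw [map_add] at hdeg
  have hc : c = 0 := (Finsupp.degree_eq_zero_iff c).1 (by omega)
  subst hc
  have hr1 : r' = C (coeff 0 r') := totalDegree_eq_zero_iff_eq_C.1 (by omega)
  rw [add_zero] at huv hr' ⊢
  rw [hr1, mul_comm] at hr'
  have h1 := congrArg (coeff a) hr'
  rw [coeff_C_mul, coeff_sub, coeff_sub, coeff_monomial, coeff_monomial, coeff_monomial,
    if_pos rfl, if_neg hab.symm, if_neg huv.symm] at h1
  rw [hr', show coeff 0 r' = 1 by simpa using h1.symm]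
  simp

theorem isBinomialGenerators_binomials :
    IsBinomialGenerators A {f : MvPolynomial σ K | f ∈ toricIdeal K A ∧ IsBinomial f} := by
  refine ⟨fun g hg => hg.2, le_antisymm (Ideal.span_le.2 fun g hg => hg.1) ?_⟩
  refine toricIdeal_le_of_binomials_mem fun u v huv => ?_
  by_cases h : u = v
  · simp [h]
  · exact Ideal.subset_span ⟨binomial_mem_toricIdeal_iff.2 huv, u, v, h, rfl⟩

theorem IsBinomialGenerators.exists_minimal_subset [Finite σ] {F : Set (MvPolynomial σ K)}
    (hF : IsBinomialGenerators A F) : ∃ F' ⊆ F, Minimal (IsBinomialGenerators A) F' := by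
  have hfg : (Submodule.span (MvPolynomial σ K) F).FG := IsNoetherian.noetherian _
  obtain ⟨t, htF, ht⟩ := (Submodule.fg_span_iff_fg_span_finset_subset F).1 hfg
  have htg : IsBinomialGenerators A (t : Set (MvPolynomial σ K)) :=
    ⟨fun g hg => hF.1 g (htF hg), ht.symm.trans hF.2⟩
  have hfin : {s : Set (MvPolynomial σ K) | s ⊆ t ∧ IsBinomialGenerators A s}.Finite :=
    t.finite_toSet.finite_subsets.subset fun s hs => hs.1
  obtain ⟨s, hs⟩ := hfin.exists_minimal ⟨_, subset_rfl, htg⟩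
  exact ⟨s, hs.1.1.trans htF, hs.1.2, fun r hr hrs =>
    hs.2 ⟨(show r ⊆ s from hrs).trans hs.1.1, hr⟩ hrs⟩

theorem IsIndispensable.not_isRedundant [Finite σ] {f : MvPolynomial σ K}
    (h : IsIndispensable A f) : ¬ IsRedundant A f := by
  intro hred
  -- All binomials except `-f`; the clause `g = -f → g = f` keeps `f` in characteristic two, where
  -- `-f = f`.
  have hF : IsBinomialGenerators A
      {g : MvPolynomial σ K | g ∈ toricIdeal K A ∧ IsBinomial g ∧ (g = -f → g = f)} := by
    refine ⟨fun g hg => hg.2.1, le_antisymm (Ideal.span_le.2 fun g hg => hg.1) ?_⟩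
    refine isBinomialGenerators_binomials.2.ge.trans (Ideal.span_le.2 ?_)
    intro g hg
    by_cases hgf : g = -f
    · rw [hgf]
      exact neg_mem (Ideal.subset_span ⟨h.1, h.2.1, fun _ => rfl⟩)
    · exact Ideal.subset_span ⟨hg.1, hg.2, fun h' => absurd h' hgf⟩
  obtain ⟨F, hsub, hmin⟩ := hF.exists_minimal_subset
  refine hred ⟨F, hmin, ?_⟩
  rcases h.2.2 F hmin.1 with h1 | h1
  · exact h1
  · have := (hsub h1).2.2 rfl
    rwa [this] at h1

theorem not_isIndispensable_of_span_sfCircuits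
    (h : toricIdeal K A = Ideal.span (sfCircuits K A)) {f : MvPolynomial σ K}
    (hf : f ∉ sfCircuits K A) : ¬ IsIndispensable A f := by
  intro hind
  rcases hind.2.2 _ ⟨fun g hg => hg.1.2.1, h.symm⟩ with h1 | h1
  · exact hf h1
  · exact hf (by simpa using neg_mem_sfCircuits h1)

/-- In a representation of `g`, the multiple of `f` has no component in degree `e < d`, so taking
the component of degree `e` removes `f`. -/
theorem mem_span_diff_of_isHomogeneous {F : Set (MvPolynomial σ K)} {f g : MvPolynomial σ K}
    {d e : ℕ} (hF : ∀ q ∈ F, ∃ n, q.IsHomogeneous n) (hf : f.IsHomogeneous d)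
    (hg : g.IsHomogeneous e) (hed : e < d) (hfF : f ∈ F) (hgF : g ∈ Ideal.span F) :
    g ∈ Ideal.span (F \ {f}) := by
  classical
  let _ := MvPolynomial.gradedAlgebra (R := K) (σ := σ)
  have hhom : (Ideal.span (F \ {f})).IsHomogeneous (homogeneousSubmodule σ K) :=
    Ideal.homogeneous_span _ _ fun q hq => by
      obtain ⟨n, hn⟩ := hF q hq.1
      exact ⟨n, hn⟩
  rw [← Set.insert_sdiff_self_of_mem hfF, Ideal.mem_span_insert] at hgF
  obtain ⟨a, z, hz, rfl⟩ := hgF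
  have h1 : homogeneousComponent e z ∈ Ideal.span (F \ {f}) :=
    decomposition.decompose'_apply (R := K) z e ▸ hhom e hz
  have h2 : homogeneousComponent e (a * f) = 0 := by
    ext m
    rw [coeff_homogeneousComponent, coeff_zero]
    split_ifs with hm
    · rw [coeff_mul]
      refine Finset.sum_eq_zero fun x hx => ?_
      by_cases h0 : coeff x.2 f = 0
      · rw [h0, mul_zero]
      · have hx2 : x.2.degree = d := by
          rw [Finsupp.degree_eq_weight_one]
          exact hf h0
        rw [← Finset.HasAntidiagonal.mem_antidiagonal.1 hx, map_add] at hm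
        omega
    · rfl
  have h3 := homogeneousComponent_of_mem (m := e) (n := e) hg
  rw [if_pos rfl, map_add, h2, zero_add] at h3
  rwa [← h3]

/-- A generating system containing the binomial generates everything of lower degree without it,
hence the binomial itself, so the system is not minimal. -/
theorem isRedundant_of_mem_span_lower (hA : IsGraded A) {d : ℕ} (hu : u.degree = d)
    (hv : v.degree = d)
    (h : monomial u (1 : K) - monomial v 1 ∈ Ideal.span {g | ∃ a b : σ →₀ ℕ,
      multidegree A a = multidegree A b ∧ a.degree < d ∧ g = monomial a 1 - monomial b 1}) :
    IsRedundant A (monomial u (1 : K) - monomial v 1) := by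
  rintro ⟨F, hF, hfF⟩
  have hFh : ∀ q ∈ F, ∃ n, q.IsHomogeneous n := by
    intro q hq
    obtain ⟨a, b, hab, rfl⟩ := hF.1.1 q hq
    have := binomial_mem_toricIdeal_iff.1 (hF.1.2 ▸ Ideal.subset_span hq)
    exact ⟨_, isHomogeneous_binomial rfl (hA _ _ this).symm⟩
  have hmem : monomial u (1 : K) - monomial v 1 ∈
      Ideal.span (F \ {monomial u (1 : K) - monomial v 1}) := by
    refine Ideal.span_le.2 ?_ h
    rintro g ⟨a, b, hab, had, rfl⟩
    refine mem_span_diff_of_isHomogeneous hFh (isHomogeneous_binomial hu hv)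
      (isHomogeneous_binomial rfl (hA _ _ hab).symm) had hfF ?_
    rw [hF.1.2]
    exact binomial_mem_toricIdeal_iff.2 hab
  have hgen : IsBinomialGenerators A (F \ {monomial u (1 : K) - monomial v 1}) := by
    refine ⟨fun g hg => hF.1.1 g hg.1, ?_⟩
    rw [← hF.1.2]
    refine le_antisymm (Ideal.span_mono Set.sdiff_subset) (Ideal.span_le.2 fun g hg => ?_)
    by_cases hgf : g = monomial u (1 : K) - monomial v 1
    · rw [hgf]; exact hmem
    · exact Ideal.subset_span ⟨hg, hgf⟩
  exact (hF.2 hgen Set.sdiff_subset hfF).2 rfl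

end Systems

end

end ToricCircuits

namespace ToricCircuits

open SimpleGraph

noncomputable section

/-! ### Walks and their pairs of monomials -/

section Walks

variable {V : Type*} {G : SimpleGraph V}

/-- The edges of a walk in odd (`b = true`) or even (`b = false`) position, with multiplicities. -/
def edgePart : ∀ {x y : V}, G.Walk x y → Bool → (G.edgeSet →₀ ℕ)
  | _, _, .nil => fun _ => 0
  | _, _, .cons h p => fun b =>
      (if b then Finsupp.single ⟨s(_, _), h⟩ 1 else 0) + edgePart p (!b)

variable {x y z : V}

@[simp] theorem edgePart_nil (b : Bool) : edgePart (.nil : G.Walk x x) b = 0 := rfl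

theorem edgePart_cons (h : G.Adj x y) (p : G.Walk y z) (b : Bool) :
    edgePart (.cons h p) b =
      (if b then Finsupp.single ⟨s(x, y), h⟩ 1 else 0) + edgePart p (!b) := rfl

theorem edgePart_append (p : G.Walk x y) (q : G.Walk y z) :
    ∀ b, edgePart (p.append q) b = edgePart p b +
      edgePart q (if Even p.length then b else !b) := by
  induction p with
  | nil => simp
  | cons h p ih =>
    intro b
    rw [Walk.cons_append, edgePart_cons, ih, edgePart_cons, add_assoc, Walk.length_cons]
    congr 3
    by_cases he : Even p.length <;> simp [he, Nat.even_add_one]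

theorem edgePart_append_even {p : G.Walk x y} (q : G.Walk y z) (hp : Even p.length) (b : Bool) :
    edgePart (p.append q) b = edgePart p b + edgePart q b := by
  rw [edgePart_append, if_pos hp]

theorem edgePart_append_odd {p : G.Walk x y} (q : G.Walk y z) (hp : Odd p.length) (b : Bool) :
    edgePart (p.append q) b = edgePart p b + edgePart q (!b) := by
  rw [edgePart_append, if_neg (Nat.not_even_iff_odd.2 hp)]

theorem edgePart_reverse (p : G.Walk x y) :
    ∀ b, edgePart p.reverse b = edgePart p (if Even p.length then !b else b) := by
  induction p with
  | nil => simp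
  | @cons x' y' z' h p ih =>
    intro b
    rw [Walk.reverse_cons, edgePart_append, ih, edgePart_cons, edgePart_cons, Walk.length_reverse,
      Walk.length_cons]
    have hs : (⟨s(y', x'), h.symm⟩ : G.edgeSet) = ⟨s(x', y'), h⟩ := Subtype.ext Sym2.eq_swap
    rw [hs]
    by_cases he : Even p.length <;> cases b <;> simp [he, Nat.even_add_one] <;> abel

theorem edgePart_reverse_odd {p : G.Walk x y} (hp : Odd p.length) (b : Bool) :
    edgePart p.reverse b = edgePart p b := by
  rw [edgePart_reverse, if_neg (Nat.not_even_iff_odd.2 hp)]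

theorem edgePart_reverse_even {p : G.Walk x y} (hp : Even p.length) (b : Bool) :
    edgePart p.reverse b = edgePart p (!b) := by
  rw [edgePart_reverse, if_pos hp]

theorem degree_edgePart (p : G.Walk x y) :
    (edgePart p true).degree = (p.length + 1) / 2 ∧ (edgePart p false).degree = p.length / 2 := by
  induction p with
  | nil => simp
  | cons h p ih =>
    rw [edgePart_cons, edgePart_cons, Walk.length_cons]
    simp only [map_add, if_true, Bool.not_true, Bool.not_false, Finsupp.degree_single,
      Bool.false_eq_true, if_false, map_zero, ih]
    omega

theorem edgePart_add_edgePart [DecidableEq V] (p : G.Walk x y) (e : G.edgeSet) :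
    edgePart p true e + edgePart p false e = p.edges.count (e : Sym2 V) := by
  induction p with
  | nil => simp
  | @cons x' y' z' h p ih =>
    rw [edgePart_cons, edgePart_cons, Walk.edges_cons, List.count_cons, ← ih]
    simp only [if_true, Bool.not_true, Bool.not_false, Bool.false_eq_true, if_false, zero_add,
      Finsupp.add_apply, Finsupp.single_apply, Subtype.ext_iff, beq_iff_eq]
    ring

theorem mem_edges_of_edgePart_ne_zero {p : G.Walk x y} {e : G.edgeSet} {b : Bool}
    (h : edgePart p b e ≠ 0) : (e : Sym2 V) ∈ p.edges := by
  classical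
  rw [← List.count_pos_iff, ← edgePart_add_edgePart]
  cases b <;> omega

section Multidegree

variable [Fintype V]

theorem multidegree_edge (h : G.Adj x y) :
    multidegree (edgeMatrix G) (Finsupp.single ⟨s(x, y), h⟩ 1) =
      Finsupp.single x 1 + Finsupp.single y 1 := by
  classical
  ext v
  rw [multidegree_single, edgeMatrix, Matrix.of_apply]
  simp only [Sym2.mem_iff, Finsupp.add_apply, Finsupp.single_apply]
  have := h.ne
  by_cases h1 : v = x
  · subst h1; simp [this.symm]
  · by_cases h2 : v = y
    · subst h2; simp [this]
    · simp [h1, h2, Ne.symm h1, Ne.symm h2]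

/-- At each interior passage through a vertex the incoming and the outgoing edge have opposite
parity, so only the two ends contribute to the difference. -/
theorem multidegree_edgePart (p : G.Walk x y) :
    (Even p.length → multidegree (edgeMatrix G) (edgePart p true) + Finsupp.single y 1 =
      multidegree (edgeMatrix G) (edgePart p false) + Finsupp.single x 1) ∧
    (Odd p.length → multidegree (edgeMatrix G) (edgePart p true) =
      multidegree (edgeMatrix G) (edgePart p false) + Finsupp.single x 1 +
        Finsupp.single y 1) := by
  induction p with
  | nil => simp
  | cons h p ih =>
    rw [edgePart_cons, edgePart_cons, Walk.length_cons, Nat.even_add_one, Nat.odd_add_one,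
      Nat.not_even_iff_odd, Nat.not_odd_iff_even]
    simp only [map_add, if_true, Bool.not_true, Bool.not_false, Bool.false_eq_true, if_false,
      zero_add, multidegree_edge]
    refine ⟨fun ho => ?_, fun he => ?_⟩
    · rw [ih.2 ho]; abel
    · have := ih.1 he
      rw [add_right_comm _ _ (Finsupp.single _ 1), add_assoc, add_comm _ (Finsupp.single _ 1),
        add_comm _ (Finsupp.single _ 1), ← add_assoc] at *
      ext v
      have := DFunLike.congr_fun this v
      simp only [Finsupp.add_apply] at this ⊢
      omega

theorem multidegree_edgePart_closed {p : G.Walk x x} (hp : Even p.length) :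
    multidegree (edgeMatrix G) (edgePart p true) =
      multidegree (edgeMatrix G) (edgePart p false) :=
  add_right_cancel ((multidegree_edgePart p).1 hp)

theorem degree_multidegree (u : G.edgeSet →₀ ℕ) :
    (multidegree (edgeMatrix G) u).degree = 2 * u.degree := by
  induction u using Finsupp.induction_linear with
  | zero => simp
  | add f g hf hg => rw [map_add, map_add, map_add, hf, hg]; ring
  | single e n =>
    obtain ⟨e, he⟩ := e
    induction e with
    | _ x y =>
    rw [show (Finsupp.single (⟨s(x, y), he⟩ : G.edgeSet) n) = n • Finsupp.single ⟨s(x, y), he⟩ 1 by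
      simp, map_nsmul, multidegree_edge he]
    simp
    ring

theorem isGraded_edgeMatrix : IsGraded (edgeMatrix G) := by
  intro u v h
  have h1 := congrArg Finsupp.degree h
  rw [degree_multidegree, degree_multidegree] at h1
  omega

theorem exists_edge_of_multidegree_ne_zero {u : G.edgeSet →₀ ℕ}
    (h : multidegree (edgeMatrix G) u x ≠ 0) :
    ∃ (y : V) (hxy : G.Adj x y) (u' : G.edgeSet →₀ ℕ), u = Finsupp.single ⟨s(x, y), hxy⟩ 1 + u' := by
  rw [multidegree_apply, Finsupp.sum] at h
  obtain ⟨e, he, hne⟩ := Finset.exists_ne_zero_of_sum_ne_zero h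
  have hx : x ∈ (e : Sym2 V) := by
    by_contra hx
    simp [edgeMatrix, hx] at hne
  obtain ⟨e, hadj⟩ := e
  obtain ⟨y, rfl⟩ := Sym2.mem_iff_exists.1 hx
  refine ⟨y, hadj, ?_⟩
  exact exists_add_of_le (by
    rw [Finsupp.single_le_iff]
    have := Finsupp.mem_support_iff.1 he
    omega)

end Multidegree

end Walks

/-! ### Surgery on even closed walks of minimal degree -/

section Connection

variable {V : Type*} {G : SimpleGraph V} {x y z : V}

/-- The two monomials defined by an even closed walk of length `2 * d` are not related. -/
def IsObstruction (c : AddCon (G.edgeSet →₀ ℕ)) (d : ℕ) (p : G.Walk x x) : Prop :=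
  p.length = 2 * d ∧ ¬ c (edgePart p true) (edgePart p false)

variable {c : AddCon (G.edgeSet →₀ ℕ)} {d : ℕ}

/-- Moving the base point by an odd number of steps swaps the two monomials, which is harmless
because `c` is symmetric. -/
theorem IsObstruction.rotate {p : G.Walk x y} {q : G.Walk y x}
    (h : IsObstruction c d (p.append q)) : IsObstruction c d (q.append p) := by
  obtain ⟨h1, h2⟩ := h
  rw [Walk.length_append] at h1
  refine ⟨by rw [Walk.length_append]; omega, fun h3 => h2 ?_⟩
  by_cases hp : Even p.length
  · have hq : Even q.length := by grind
    rw [edgePart_append_even _ hp, edgePart_append_even _ hp]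
    rw [edgePart_append_even _ hq, edgePart_append_even _ hq] at h3
    rwa [add_comm, add_comm (edgePart p false)]
  · have hp : Odd p.length := Nat.not_even_iff_odd.1 hp
    have hq : Odd q.length := by grind
    rw [edgePart_append_odd _ hp, edgePart_append_odd _ hp]
    rw [edgePart_append_odd _ hq, edgePart_append_odd _ hq] at h3
    rw [add_comm, add_comm (edgePart p false)]
    exact c.symm h3

/-- Reversing an odd closed subwalk preserves the parity of the position of each of its edges. This
allows the parity of an arc to be switched later. -/
theorem IsObstruction.reverse_left {p : G.Walk x x} {q : G.Walk x x} (hp : Odd p.length)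
    (h : IsObstruction c d (p.append q)) : IsObstruction c d (p.reverse.append q) := by
  obtain ⟨h1, h2⟩ := h
  refine ⟨by simpa using h1, fun h3 => h2 ?_⟩
  have hr : Odd p.reverse.length := by simpa using hp
  rw [edgePart_append_odd _ hp, edgePart_append_odd _ hp]
  rwa [edgePart_append_odd _ hr, edgePart_append_odd _ hr, edgePart_reverse_odd hp,
    edgePart_reverse_odd hp] at h3

variable [Fintype V]

/-- All pairs of monomials with equal multidegree and of degree less than `d` are related. -/
def RelatesBelow (c : AddCon (G.edgeSet →₀ ℕ)) (d : ℕ) : Prop :=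
  ∀ u v, multidegree (edgeMatrix G) u = multidegree (edgeMatrix G) v → u.degree < d → c u v

theorem RelatesBelow.add_left (hc : RelatesBelow c d) {w a b : G.edgeSet →₀ ℕ}
    (hab : multidegree (edgeMatrix G) a = multidegree (edgeMatrix G) b)
    (hd : (w + a).degree = d) (hw : w.degree ≠ 0) : c (w + a) (w + b) := by
  refine c.add (c.refl w) (hc a b hab ?_)
  rw [map_add] at hd
  omega

/-- If both parts were nontrivial, exchanging the monomials of `p` and then those of `q` would be
two moves with a common factor, each reducible to lower degree. -/
theorem IsObstruction.length_eq_zero_of_even (hc : RelatesBelow c d) {p q : G.Walk x x}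
    (h : IsObstruction c d (p.append q)) (hp : Even p.length) :
    p.length = 0 ∨ q.length = 0 := by
  obtain ⟨h1, h2⟩ := h
  by_contra! hcon
  rw [Walk.length_append] at h1
  have hq : Even q.length := by grind
  refine h2 ?_
  rw [edgePart_append_even _ hp, edgePart_append_even _ hp]
  have dp := degree_edgePart p
  have dq := degree_edgePart q
  have hp2 : 2 ≤ p.length := by grind
  have hq2 : 2 ≤ q.length := by grind
  have h3 : c (edgePart q true + edgePart p true) (edgePart q true + edgePart p false) :=
    hc.add_left (multidegree_edgePart_closed hp) (by rw [map_add]; grind) (by omega)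
  have h4 : c (edgePart p false + edgePart q true) (edgePart p false + edgePart q false) :=
    hc.add_left (multidegree_edgePart_closed hq) (by rw [map_add]; grind) (by omega)
  rw [add_comm (edgePart p true)]
  refine c.trans h3 ?_
  rwa [add_comm]

/-- The chord closes each odd arc to an even closed walk. If both arcs were longer than 1, the two
monomials would be linked through one containing the chord, with a common factor at each move. -/
theorem IsObstruction.length_eq_one_of_adj (hc : RelatesBelow c d) {p : G.Walk x y}
    {q : G.Walk y x} (h : IsObstruction c d (p.append q)) (hp : Odd p.length) (hxy : G.Adj x y) :
    p.length = 1 ∨ q.length = 1 := by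
  obtain ⟨h1, h2⟩ := h
  by_contra! hcon
  rw [Walk.length_append] at h1
  have hq : Odd q.length := by grind
  refine h2 ?_
  rw [edgePart_append_odd _ hp, edgePart_append_odd _ hp]
  have dp := degree_edgePart p
  have dq := degree_edgePart q
  have hp2 : 3 ≤ p.length := by grind
  have hq2 : 3 ≤ q.length := by grind
  set e : G.edgeSet →₀ ℕ := Finsupp.single ⟨s(x, y), hxy⟩ 1 with he
  have hme : multidegree (edgeMatrix G) e = Finsupp.single x 1 + Finsupp.single y 1 :=
    multidegree_edge hxy
  have h3 : c (edgePart q false + edgePart p true) (edgePart q false + (edgePart p false + e)) := by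
    refine hc.add_left ?_ (by rw [map_add]; grind) (by omega)
    rw [(multidegree_edgePart p).2 hp, map_add, hme, add_assoc]
  have h4 : c (edgePart p false + edgePart q true) (edgePart p false + (edgePart q false + e)) := by
    refine hc.add_left ?_ (by rw [map_add]; grind) (by omega)
    rw [(multidegree_edgePart q).2 hq, map_add, hme, add_assoc, add_comm (Finsupp.single y 1)]
  rw [Bool.not_true, Bool.not_false, add_comm (edgePart p true)]
  refine c.trans h3 (c.symm ?_)
  rwa [add_left_comm]

/-- By the parity `ho'`, an edge from `y` to `z` is a chord between odd arcs of length at least 2.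
If `y = z`, reversing the first closed walk creates a splitting into two even closed walks. -/
theorem IsObstruction.not_adj_of_odd (hc : RelatesBelow c d) {p₁ : G.Walk x y} {p₂ : G.Walk y x}
    {q₁ : G.Walk x z} {q₂ : G.Walk z x}
    (h : IsObstruction c d ((p₁.append p₂).append (q₁.append q₂)))
    (hp₁ : p₁.length ≠ 0) (hp₂ : p₂.length ≠ 0) (hq₁ : q₁.length ≠ 0) (hq₂ : q₂.length ≠ 0)
    (ho : Odd (p₁.length + p₂.length)) (ho' : Odd (p₂.length + q₁.length)) :
    ¬ G.Adj y z ∧ y ≠ z := by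
  have h' : IsObstruction c d ((p₂.append q₁).append (q₂.append p₁)) := by
    have : IsObstruction c d (p₁.append (p₂.append (q₁.append q₂))) := by
      rwa [Walk.append_assoc]
    have := this.rotate
    rwa [← Walk.append_assoc, ← Walk.append_assoc, Walk.append_assoc] at this
  constructor
  · intro hyz
    have := h'.length_eq_one_of_adj hc (by rwa [Walk.length_append]) hyz
    simp only [Walk.length_append] at this
    omega
  · rintro rfl
    have hr := h.reverse_left (by rwa [Walk.length_append])
    rw [Walk.reverse_append] at hr
    have : IsObstruction c d (p₂.reverse.append (p₁.reverse.append (q₁.append q₂))) := by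
      rwa [Walk.append_assoc]
    have := this.rotate
    rw [← Walk.append_assoc, ← Walk.append_assoc, Walk.append_assoc] at this
    have := this.length_eq_zero_of_even hc (by simp only [Walk.length_append, Walk.length_reverse]; grind)
    simp only [Walk.length_append, Walk.length_reverse] at this
    omega

theorem IsObstruction.not_adj (hc : RelatesBelow c d) {p₁ : G.Walk x y} {p₂ : G.Walk y x}
    {q₁ : G.Walk x z} {q₂ : G.Walk z x}
    (h : IsObstruction c d ((p₁.append p₂).append (q₁.append q₂)))
    (hp₁ : p₁.length ≠ 0) (hp₂ : p₂.length ≠ 0) (hq₁ : q₁.length ≠ 0) (hq₂ : q₂.length ≠ 0)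
    (ho : Odd (p₁.length + p₂.length)) : ¬ G.Adj y z ∧ y ≠ z := by
  by_cases ho' : Odd (p₂.length + q₁.length)
  · exact h.not_adj_of_odd hc hp₁ hp₂ hq₁ hq₂ ho ho'
  -- Reversal exchanges the roles of `p₁` and `p₂`, whose lengths have different parity.
  · have hr := h.reverse_left (by rwa [Walk.length_append])
    rw [Walk.reverse_append] at hr
    exact hr.not_adj_of_odd hc (by rwa [Walk.length_reverse]) (by rwa [Walk.length_reverse]) hq₁ hq₂ (by simpa [add_comm] using ho)
      (by rw [Walk.length_reverse]; grind)

/-- Edges are taken alternately from `u` and `v`. As long as the walk has not returned to `s`,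
equality of multidegrees supplies an unused edge of `u` at its current end. -/
theorem exists_closed_walk_le_aux {u v : G.edgeSet →₀ ℕ}
    (huv : multidegree (edgeMatrix G) u = multidegree (edgeMatrix G) v) :
    ∀ (n : ℕ) (s t : V) (p : G.Walk s t) (u' v' : G.edgeSet →₀ ℕ), u'.degree = n →
      Even p.length → u = edgePart p true + u' → v = edgePart p false + v' →
      multidegree (edgeMatrix G) u' t ≠ 0 →
      ∃ (x : V) (q : G.Walk x x), Even q.length ∧ q.length ≠ 0 ∧ edgePart q true ≤ u ∧
        edgePart q false ≤ v := by
  classical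
  intro n
  induction n using Nat.strong_induction_on with
  | _ n ih =>
  intro s t p u' v' hn hp hu hv ht
  obtain ⟨t', h₁, u'', rfl⟩ := exists_edge_of_multidegree_ne_zero ht
  have hbal : multidegree (edgeMatrix G) u'' + Finsupp.single t' 1 + Finsupp.single s 1 =
      multidegree (edgeMatrix G) v' := by
    have h2 := (multidegree_edgePart p).1 hp
    rw [hu, hv, map_add, map_add, map_add, multidegree_edge] at huv
    ext w
    have h3 := DFunLike.congr_fun huv w
    have h4 := DFunLike.congr_fun h2 w
    simp only [Finsupp.add_apply] at h3 h4 ⊢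
    omega
  obtain ⟨t'', h₂, v'', rfl⟩ : ∃ (t'' : V) (h : G.Adj t' t'') (v'' : G.edgeSet →₀ ℕ),
      v' = Finsupp.single ⟨s(t', t''), h⟩ 1 + v'' := by
    refine exists_edge_of_multidegree_ne_zero ?_
    rw [← hbal]
    simp
  set q := p.append (.cons h₁ (.cons h₂ .nil)) with hq
  have hq1 : u = edgePart q true + u'' := by
    rw [hq, edgePart_append_even _ hp, hu]
    simp [edgePart_cons, add_assoc]
  have hq2 : v = edgePart q false + v'' := by
    rw [hq, edgePart_append_even _ hp, hv]
    simp [edgePart_cons, add_assoc]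
  have hqe : Even q.length := by
    rw [hq, Walk.length_append]
    simp only [Walk.length_cons, Walk.length_nil]
    grind
  by_cases hst : t'' = s
  · subst hst
    refine ⟨t'', q, hqe, ?_, ?_, ?_⟩
    · rw [hq, Walk.length_append]; simp
    · exact le_iff_exists_add.2 ⟨_, hq1⟩
    · exact le_iff_exists_add.2 ⟨_, hq2⟩
  · refine ih u''.degree ?_ s t'' q u'' v'' rfl hqe hq1 hq2 ?_
    · rw [map_add, Finsupp.degree_single] at hn
      omega
    · rw [map_add, multidegree_edge] at hbal
      have h3 := DFunLike.congr_fun hbal t''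
      simp only [Finsupp.add_apply, Finsupp.single_apply] at h3
      simp [h₂.ne, Ne.symm hst] at h3
      omega

theorem exists_closed_walk_le {u v : G.edgeSet →₀ ℕ}
    (huv : multidegree (edgeMatrix G) u = multidegree (edgeMatrix G) v) (hu : u ≠ 0) :
    ∃ (x : V) (q : G.Walk x x), Even q.length ∧ q.length ≠ 0 ∧ edgePart q true ≤ u ∧
      edgePart q false ≤ v := by
  obtain ⟨s, hs⟩ : ∃ s, multidegree (edgeMatrix G) u s ≠ 0 := by
    by_contra! hcon
    have h0 : multidegree (edgeMatrix G) u = 0 := Finsupp.ext hcon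
    have := degree_multidegree u
    rw [h0, map_zero] at this
    exact hu ((Finsupp.degree_eq_zero_iff u).1 (by omega))
  exact exists_closed_walk_le_aux huv _ s s .nil u v rfl (by simp) (by simp) (by simp) hs

/-- If the closed walk did not exhaust `u` and `v`, replacing first its monomial and then the
remaining factor would relate them through lower degrees. -/
theorem RelatesBelow.exists_isObstruction (hc : RelatesBelow c d) {u v : G.edgeSet →₀ ℕ}
    (huv : multidegree (edgeMatrix G) u = multidegree (edgeMatrix G) v) (hu : u.degree = d)
    (h : ¬ c u v) : ∃ (x : V) (p : G.Walk x x), IsObstruction c d p ∧ u = edgePart p true ∧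
      v = edgePart p false := by
  have hu0 : u ≠ 0 := by
    rintro rfl
    have := isGraded_edgeMatrix _ _ huv
    rw [map_zero] at this
    rw [(Finsupp.degree_eq_zero_iff v).1 this.symm] at h
    exact h (c.refl 0)
  obtain ⟨x, p, hp, hp0, hpu, hpv⟩ := exists_closed_walk_le huv hu0
  obtain ⟨u', rfl⟩ := exists_add_of_le hpu
  obtain ⟨v', rfl⟩ := exists_add_of_le hpv
  have hm := multidegree_edgePart_closed hp
  have hm' : multidegree (edgeMatrix G) u' = multidegree (edgeMatrix G) v' := by
    rw [map_add, map_add, hm] at huv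
    exact add_left_cancel huv
  have hdp := degree_edgePart p
  have hdu := isGraded_edgeMatrix _ _ hm'
  have hu' : u' = 0 := by
    by_contra hne
    have hne : u'.degree ≠ 0 := mt (Finsupp.degree_eq_zero_iff u').1 hne
    refine h (c.trans (y := u' + edgePart p false) ?_ ?_)
    · rw [add_comm _ u']
      exact hc.add_left hm (by rw [add_comm, hu]) hne
    · rw [add_comm u']
      refine hc.add_left hm' ?_ (by grind)
      rw [← hu, map_add, map_add]
      grind
  subst hu'
  have hv' : v' = 0 := (Finsupp.degree_eq_zero_iff v').1 (by rw [← hdu, map_zero])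
  subst hv'
  rw [add_zero] at h hu
  rw [add_zero] at h
  exact ⟨x, p, ⟨by grind, h⟩, by simp, by simp⟩

end Connection

end

end ToricCircuits

namespace ToricCircuits

open SimpleGraph

noncomputable section

/-! ### Integer kernel vectors on even cycles and dumbbells -/

section Kernel

variable {V : Type*} {G : SimpleGraph V} {a b x y : V}

/-- The function on pairs of vertices given by a function on the edges. -/
def edgeWeight (u : G.edgeSet →₀ ℕ) (x y : V) : ℕ :=
  open Classical in if h : G.Adj x y then u ⟨s(x, y), h⟩ else 0

theorem edgeWeight_of_adj (u : G.edgeSet →₀ ℕ) (h : G.Adj x y) :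
    edgeWeight u x y = u ⟨s(x, y), h⟩ := dif_pos h

theorem exists_getVert_of_mem_edges {p : G.Walk x y} {s t : V} (h : s(s, t) ∈ p.edges) :
    ∃ i < p.length, (s = p.getVert i ∧ t = p.getVert (i + 1)) ∨
      (s = p.getVert (i + 1) ∧ t = p.getVert i) := by
  induction p with
  | nil => simp at h
  | cons hadj p ih =>
    rw [Walk.edges_cons, List.mem_cons] at h
    rcases h with h | h
    · refine ⟨0, by simp, ?_⟩
      rw [Sym2.eq_iff] at h
      simpa using h
    · obtain ⟨i, hi, hi'⟩ := ih h
      exact ⟨i + 1, by simpa using hi, by simpa using hi'⟩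

theorem eq_getVert_of_isPath {p : G.Walk x y} (hp : p.IsPath) {i : ℕ} (hi : i ≤ p.length) {t : V}
    (h : s(p.getVert i, t) ∈ p.edges) :
    t = p.getVert (i + 1) ∨ (0 < i ∧ t = p.getVert (i - 1)) := by
  obtain ⟨j, hj, ⟨h1, rfl⟩ | ⟨h1, rfl⟩⟩ := exists_getVert_of_mem_edges h
  · have := hp.getVert_injOn (by simpa using hi) (by simpa using hj.le) h1
    subst this
    exact Or.inl rfl
  · have := hp.getVert_injOn (by simpa using hi) (by simpa using hj) h1
    subst this
    exact Or.inr ⟨by omega, rfl⟩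

theorem eq_getVert_of_isCycle {p : G.Walk x x} (hp : p.IsCycle) {i : ℕ} (hi : i < p.length) {t : V}
    (h : s(p.getVert i, t) ∈ p.edges) :
    t = p.getVert (i + 1) ∨ (0 < i ∧ t = p.getVert (i - 1)) ∨
      (i = 0 ∧ t = p.getVert (p.length - 1)) := by
  have h3 := hp.three_le_length
  have hinj := hp.getVert_injOn'
  obtain ⟨j, hj, ⟨h1, rfl⟩ | ⟨h1, rfl⟩⟩ := exists_getVert_of_mem_edges h
  · have := hinj (x₁ := i) (x₂ := j) (by simp; omega) (by simp; omega) h1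
    subst this
    exact Or.inl rfl
  · by_cases hj' : j + 1 = p.length
    · rw [hj', Walk.getVert_length] at h1
      have := hinj (x₁ := i) (x₂ := 0) (by simp; omega) (by simp) (by simpa using h1)
      subst this
      exact Or.inr (Or.inr ⟨rfl, by rw [← hj']; rfl⟩)
    · have := hinj (x₁ := i) (x₂ := j + 1) (by simp; omega) (by simp; omega) h1
      subst this
      exact Or.inr (Or.inl ⟨by omega, rfl⟩)

variable [Fintype V]

theorem sum_edgeWeight (u : G.edgeSet →₀ ℕ) (x : V) :
    ∑ y, edgeWeight u x y = multidegree (edgeMatrix G) u x := by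
  classical
  induction u using Finsupp.induction_linear with
  | zero => simp [edgeWeight]
  | add f g hf hg =>
    rw [map_add, Finsupp.add_apply, ← hf, ← hg, ← Finset.sum_add_distrib]
    refine Finset.sum_congr rfl fun y _ => ?_
    unfold edgeWeight
    split_ifs <;> simp
  | single e n =>
    obtain ⟨e, he⟩ := e
    rw [multidegree_single, edgeMatrix, Matrix.of_apply]
    by_cases hx : x ∈ e
    · obtain ⟨y, rfl⟩ := Sym2.mem_iff_exists.1 hx
      rw [Finset.sum_eq_single y]
      · rw [edgeWeight_of_adj _ he]; simp
      · intro z _ hz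
        unfold edgeWeight
        split_ifs with h
        · refine Finsupp.single_eq_of_ne ?_
          intro h'
          exact hz (Sym2.congr_right.1 (Subtype.ext_iff.1 h'))
        · rfl
      · simp
    · simp only [hx, if_false, mul_zero]
      refine Finset.sum_eq_zero fun y _ => ?_
      unfold edgeWeight
      split_ifs with h
      · refine Finsupp.single_eq_of_ne ?_
        intro h'
        have h'' : s(x, y) = e := Subtype.ext_iff.1 h'
        exact hx (h'' ▸ Sym2.mem_mk_left _ _)
      · rfl

/-- A symmetric function with vanishing row sums: an integer vector in the kernel of `A_G`. -/
structure IsBalanced (w : V → V → ℤ) : Prop where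
  symm : ∀ x y, w x y = w y x
  sum : ∀ x, ∑ y, w x y = 0

variable {w : V → V → ℤ}

theorem IsBalanced.add_eq_zero (hw : IsBalanced w) {y₁ y₂ : V} (h : y₁ ≠ y₂)
    (hx : ∀ y, w x y ≠ 0 → y = y₁ ∨ y = y₂) : w x y₁ + w x y₂ = 0 := by
  classical
  rw [← hw.sum x, ← Finset.sum_pair h]
  refine Finset.sum_subset (Finset.subset_univ _) fun y _ hy => ?_
  by_contra hne
  exact hy (by simpa using hx y hne)

theorem IsBalanced.eq_zero (hw : IsBalanced w) {y₁ : V} (hx : ∀ y, y ≠ y₁ → w x y = 0) :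
    w x y₁ = 0 := by
  rw [← hw.sum x, Finset.sum_eq_single y₁ (fun y _ hy => hx y hy) (by simp)]

/-- Where only two incident edges carry weight, their weights are opposite; so one edge determines
all weights along a path or a cycle. -/
theorem IsBalanced.alternates (hw : IsBalanced w) (p : G.Walk x y)
    (h : ∀ i, i + 1 < p.length → w (p.getVert (i + 1)) (p.getVert i) +
      w (p.getVert (i + 1)) (p.getVert (i + 2)) = 0) :
    ∀ i < p.length, w (p.getVert i) (p.getVert (i + 1)) =
      (-1) ^ i * w (p.getVert 0) (p.getVert 1) := by
  intro i
  induction i with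
  | zero => simp
  | succ i ih =>
    intro hi
    have h1 := h i hi
    have h2 := ih (by omega)
    rw [hw.symm, h2] at h1
    rw [pow_succ]
    linarith

theorem IsBalanced.eq_zero_of_mem_edges (hw : IsBalanced w) {p : G.Walk x y}
    (h : ∀ i < p.length, w (p.getVert i) (p.getVert (i + 1)) = 0) {s t : V}
    (hst : s(s, t) ∈ p.edges) : w s t = 0 := by
  obtain ⟨i, hi, ⟨rfl, rfl⟩ | ⟨rfl, rfl⟩⟩ := exists_getVert_of_mem_edges hst
  · exact h i hi
  · rw [hw.symm]; exact h i hi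

theorem IsBalanced.alternates_of_isPath (hw : IsBalanced w) {p : G.Walk x y} (hp : p.IsPath)
    (h : ∀ z ∈ p.support, z ≠ x → z ≠ y → ∀ t, w z t ≠ 0 → s(z, t) ∈ p.edges) :
    ∀ i < p.length, w (p.getVert i) (p.getVert (i + 1)) =
      (-1) ^ i * w (p.getVert 0) (p.getVert 1) := by
  refine hw.alternates p fun i hi => hw.add_eq_zero ?_ ?_
  · intro he
    have := hp.getVert_injOn (x₁ := i) (x₂ := i + 2) (by simp; omega) (by simp; omega) he
    omega
  · intro t ht
    have h1 := h _ (p.getVert_mem_support (i + 1)) ?_ ?_ t ht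
    · rcases eq_getVert_of_isPath hp hi.le h1 with h2 | ⟨-, h2⟩
      · exact Or.inr h2
      · exact Or.inl h2
    · intro he
      have := hp.getVert_injOn (x₁ := i + 1) (x₂ := 0) (by simp; omega) (by simp) (by simpa using he)
      omega
    · intro he
      have := hp.getVert_injOn (x₁ := i + 1) (x₂ := p.length) (by simp; omega) (by simp)
        (by simpa using he)
      omega

theorem IsBalanced.alternates_of_isCycle (hw : IsBalanced w) {p : G.Walk x x} (hp : p.IsCycle)
    (h : ∀ z ∈ p.support, z ≠ x → ∀ t, w z t ≠ 0 → s(z, t) ∈ p.edges) :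
    ∀ i < p.length, w (p.getVert i) (p.getVert (i + 1)) =
      (-1) ^ i * w (p.getVert 0) (p.getVert 1) := by
  refine hw.alternates p fun i hi => hw.add_eq_zero ?_ ?_
  · exact hp.getVert_sub_one_ne_getVert_add_one (i := i + 1) (by omega)
  · intro t ht
    have h1 := h _ (p.getVert_mem_support (i + 1)) ?_ t ht
    · rcases eq_getVert_of_isCycle hp hi h1 with h2 | ⟨-, h2⟩ | ⟨h2, -⟩
      · exact Or.inr h2
      · exact Or.inl h2
      · omega
    · intro he
      have := hp.getVert_injOn' (x₁ := i + 1) (x₂ := 0) (by simp; omega) (by simp)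
        (by simpa using he)
      omega

theorem IsBalanced.eq_zero_of_isCycle (hw : IsBalanced w) {p : G.Walk x x} (hp : p.IsCycle)
    (h : ∀ z ∈ p.support, z ≠ x → ∀ t, w z t ≠ 0 → s(z, t) ∈ p.edges) (h0 : w x p.snd = 0)
    {s t : V} (hst : s(s, t) ∈ p.edges) : w s t = 0 := by
  refine hw.eq_zero_of_mem_edges (fun i hi => ?_) hst
  rw [hw.alternates_of_isCycle hp h i hi, Walk.getVert_zero]
  exact mul_eq_zero_of_right _ h0

/-- Two cycles `c₁`, `c₂` and a path `p`, possibly of length `0`, from a vertex of `c₁` to a vertex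
of `c₂`, which have no further common vertices. The cycle `c₂` is odd. -/
structure IsDumbbell (c₁ : G.Walk a a) (p : G.Walk a b) (c₂ : G.Walk b b) : Prop where
  odd₁ : IsOddCycle c₁
  odd₂ : IsOddCycle c₂
  isPath : p.IsPath
  inter : ∀ x ∈ c₁.support, x ∈ c₂.support → x = a ∧ x = b
  inter₁ : ∀ x ∈ p.support, x ∈ c₁.support → x = a
  inter₂ : ∀ x ∈ p.support, x ∈ c₂.support → x = b

variable {c₁ : G.Walk a a} {p : G.Walk a b} {c₂ : G.Walk b b}

/-- Zero propagates around `c₁`, then along `p`. At `b` only the two edges of `c₂` remain: the sum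
there makes them opposite, while alternation around an odd cycle makes them equal. -/
theorem IsBalanced.eq_zero_of_isDumbbell (hw : IsBalanced w) (hD : IsDumbbell c₁ p c₂)
    (hS : ∀ x y, w x y ≠ 0 → s(x, y) ∈ c₁.edges ∨ s(x, y) ∈ p.edges ∨ s(x, y) ∈ c₂.edges)
    (h0 : w a c₁.snd = 0) : ∀ x y, w x y = 0 := by
  have hc₁ : ∀ {s t : V}, s(s, t) ∈ c₁.edges → w s t = 0 := by
    refine hw.eq_zero_of_isCycle hD.odd₁.1 (fun z hz hza t ht => ?_) h0
    rcases hS z t ht with h | h | h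
    · exact h
    · exact absurd (hD.inter₁ z (p.fst_mem_support_of_mem_edges h) hz) hza
    · exact absurd (hD.inter z hz (c₂.fst_mem_support_of_mem_edges h)).1 hza
  have hp : ∀ {s t : V}, s(s, t) ∈ p.edges → w s t = 0 := by
    refine hw.eq_zero_of_mem_edges fun i hi => ?_
    rw [hw.alternates_of_isPath hD.isPath ?_ i hi, Walk.getVert_zero]
    · refine mul_eq_zero_of_right _ (hw.eq_zero fun y hy => ?_)
      by_contra hne
      have hab : a ≠ b := by
        rintro rfl
        have := Walk.length_eq_zero_iff.2 (Walk.isPath_iff_nil.1 hD.isPath)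
        omega
      rcases hS a y hne with h | h | h
      · exact hne (hc₁ h)
      · rcases eq_getVert_of_isPath hD.isPath (Nat.zero_le _) (by rwa [p.getVert_zero]) with h' | ⟨h', -⟩
        · exact hy h'
        · omega
      · exact hab (hD.inter a c₁.start_mem_support (c₂.fst_mem_support_of_mem_edges h)).2
    · intro z hz hza hzb t ht
      rcases hS z t ht with h | h | h
      · exact absurd (hD.inter₁ z hz (c₁.fst_mem_support_of_mem_edges h)) hza
      · exact h
      · exact absurd (hD.inter₂ z hz (c₂.fst_mem_support_of_mem_edges h)) hzb
  have halt := hw.alternates_of_isCycle hD.odd₂.1 (fun z hz hzb t ht => by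
    rcases hS z t ht with h | h | h
    · exact absurd (hD.inter z (c₁.fst_mem_support_of_mem_edges h) hz).2 hzb
    · exact absurd (hD.inter₂ z (p.fst_mem_support_of_mem_edges h) hz) hzb
    · exact h)
  have h3 := hD.odd₂.1.three_le_length
  -- The index of the last edge is even since `c₂` is odd, so the first and the last edge have the
  -- same weight.
  have hlast := halt (c₂.length - 1) (by omega)
  rw [Nat.sub_add_cancel (by omega), Even.neg_one_pow (by have := hD.odd₂.2; grind), one_mul,
    Walk.getVert_length, Walk.getVert_zero, hw.symm] at hlast
  have hb := hw.add_eq_zero (x := b) hD.odd₂.1.snd_ne_penultimate (fun y hy => by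
    rcases hS b y hy with h | h | h
    · exact absurd (hc₁ h) hy
    · exact absurd (hp h) hy
    · rcases eq_getVert_of_isCycle hD.odd₂.1 (i := 0) (by omega) (by rwa [c₂.getVert_zero]) with h' | ⟨h', -⟩ | ⟨-, h'⟩
      · exact Or.inl h'
      · omega
      · exact Or.inr h')
  have hc₂ : ∀ {s t : V}, s(s, t) ∈ c₂.edges → w s t = 0 := by
    refine hw.eq_zero_of_mem_edges fun i hi => ?_
    rw [halt i hi, Walk.getVert_zero]
    refine mul_eq_zero_of_right _ ?_
    change w b (c₂.getVert 1) + w b (c₂.getVert (c₂.length - 1)) = 0 at hb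
    omega
  intro x y
  by_contra hne
  rcases hS x y hne with h | h | h
  · exact hne (hc₁ h)
  · exact hne (hp h)
  · exact hne (hc₂ h)

/-- Exponent 1 at the edge `s(x, y)` lets the multiple `k` be read off there; subtracting `k` times
`u - v` leaves a balanced weight vanishing on that edge. -/
theorem generatesKernelOn_of_unique {S : Set (Sym2 V)} {u v : G.edgeSet →₀ ℕ}
    (huv : multidegree (edgeMatrix G) u = multidegree (edgeMatrix G) v)
    (hd : ∀ e, u e = 0 ∨ v e = 0) (hS : ∀ e, u e ≠ 0 ∨ v e ≠ 0 → (e : Sym2 V) ∈ S)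
    (hxy : G.Adj x y) (hu : u ⟨s(x, y), hxy⟩ = 1)
    (hw : ∀ w : V → V → ℤ, IsBalanced w → (∀ x y, w x y ≠ 0 → s(x, y) ∈ S) → w x y = 0 →
      ∀ x y, w x y = 0) :
    GeneratesKernelOn (edgeMatrix G) {e | (e : Sym2 V) ∈ S} u v := by
  have hv : v ⟨s(x, y), hxy⟩ = 0 := by have := hd ⟨s(x, y), hxy⟩; omega
  refine ⟨fun h => ?_, huv, hd, hS, fun f g hfg hm => ⟨(f ⟨s(x, y), hxy⟩ : ℤ) - g ⟨s(x, y), hxy⟩, ?_⟩⟩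
  · rw [h, hv] at hu; omega
  set k : ℤ := (f ⟨s(x, y), hxy⟩ : ℤ) - g ⟨s(x, y), hxy⟩ with hk
  have key := hw (fun x y => (edgeWeight f x y : ℤ) - edgeWeight g x y -
    k * (edgeWeight u x y - edgeWeight v x y)) ?_ ?_ ?_
  · rintro ⟨e, he⟩
    induction e with
    | _ s t =>
    have := key s t
    simp only [edgeWeight_of_adj _ (show G.Adj s t from he)] at this
    linarith
  · constructor
    · intro s t
      by_cases h : G.Adj s t
      · have he : (⟨s(t, s), h.symm⟩ : G.edgeSet) = ⟨s(s, t), h⟩ := Subtype.ext Sym2.eq_swap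
        simp only [edgeWeight_of_adj _ h, edgeWeight_of_adj _ h.symm, he]
      · have h' : ¬ G.Adj t s := fun h' => h h'.symm
        simp [edgeWeight, h, h']
    · intro s
      simp only [Finset.sum_sub_distrib, ← Finset.mul_sum, ← Nat.cast_sum, sum_edgeWeight, huv, hm]
      ring
  · intro s t hne
    by_contra hst
    refine hne ?_
    by_cases h : G.Adj s t
    · have h1 := hfg ⟨s(s, t), h⟩ hst
      have h2 := mt (hS ⟨s(s, t), h⟩) hst
      push Not at h2
      simp [edgeWeight_of_adj _ h, h1, h2]
    · simp [edgeWeight, h]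
  · simp [edgeWeight_of_adj _ hxy, hu, hv, hk]

end Kernel

end

end ToricCircuits

namespace ToricCircuits

open SimpleGraph MvPolynomial

noncomputable section

/-! ### Circuits from even cycles and dumbbells -/

section CircuitWalks

variable {V : Type*} {G : SimpleGraph V} {a b x y : V}

theorem one_le_edgePart_snd {p : G.Walk x y} (hp : ¬ p.Nil) :
    1 ≤ edgePart p true ⟨s(x, p.snd), p.adj_snd hp⟩ := by
  cases p with
  | nil => simp at hp
  | cons h p => simp [edgePart_cons]

theorem edgePart_le_one {p : G.Walk x y} (hp : p.IsTrail) (e : G.edgeSet) :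
    edgePart p true e + edgePart p false e ≤ 1 := by
  classical
  rw [edgePart_add_edgePart]
  exact hp.count_edges_le_one _

theorem edgePart_eq_zero {p : G.Walk x y} {e : G.edgeSet} (h : (e : Sym2 V) ∉ p.edges)
    (b : Bool) : edgePart p b e = 0 :=
  not_not.1 (mt mem_edges_of_edgePart_ne_zero h)

theorem exists_edgePart_ne_zero {p : G.Walk x y} (hp : 2 ≤ p.length) (b : Bool) :
    ∃ e, 1 ≤ edgePart p b e := by
  by_contra! h
  have h0 : edgePart p b = 0 := Finsupp.ext fun e => by have := h e; simpa using this
  have := degree_edgePart p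
  cases b <;> rw [h0, map_zero] at this <;> omega

/-- The even closed walk around a dumbbell, which passes the path twice. -/
def dumbbellWalk (c₁ : G.Walk a a) (p : G.Walk a b) (c₂ : G.Walk b b) : G.Walk a a :=
  (c₁.append p).append (c₂.append p.reverse)

variable {c₁ : G.Walk a a} {p : G.Walk a b} {c₂ : G.Walk b b}

/-- Since `c₂` is odd, the two passages through an edge of `p` have positions of the same parity, so
its exponent doubles. -/
theorem edgePart_dumbbellWalk (h₁ : Odd c₁.length) (h₂ : Odd c₂.length) (β : Bool) :
    edgePart (dumbbellWalk c₁ p c₂) β = edgePart c₁ β + (edgePart p (!β) + edgePart p (!β)) +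
      edgePart c₂ (if Even p.length then !β else β) := by
  rw [dumbbellWalk]
  by_cases hp : Even p.length
  · have : Odd (c₁.append p).length := by rw [Walk.length_append]; exact h₁.add_even hp
    rw [edgePart_append_odd _ this, edgePart_append_odd _ h₁, edgePart_append_odd _ h₂,
      edgePart_reverse_even hp, if_pos hp, Bool.not_not]
    abel
  · have hp' := Nat.not_even_iff_odd.1 hp
    have : Even (c₁.append p).length := by rw [Walk.length_append]; exact h₁.add_odd hp'
    rw [edgePart_append_even _ this, edgePart_append_odd _ h₁, edgePart_append_odd _ h₂,
      edgePart_reverse_odd hp', if_neg hp]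
    abel

theorem even_length_dumbbellWalk (h₁ : Odd c₁.length) (h₂ : Odd c₂.length) :
    Even (dumbbellWalk c₁ p c₂).length := by
  simp only [dumbbellWalk, Walk.length_append, Walk.length_reverse]
  grind

theorem edges_disjoint {a' b' a'' b'' z : V} {p : G.Walk a' b'} {q : G.Walk a'' b''}
    (h : ∀ x ∈ p.support, x ∈ q.support → x = z) {e : Sym2 V} (hp : e ∈ p.edges) : e ∉ q.edges := by
  intro hq
  induction e with
  | _ s t =>
  have h1 := h s (p.fst_mem_support_of_mem_edges hp) (q.fst_mem_support_of_mem_edges hq)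
  have h2 := h t (p.snd_mem_support_of_mem_edges hp) (q.snd_mem_support_of_mem_edges hq)
  have hst : G.Adj s t := p.adj_of_mem_edges hp
  exact hst.ne (h1.trans h2.symm)

theorem IsDumbbell.edgePart_cases (h : IsDumbbell c₁ p c₂) (e : G.edgeSet) :
    ((∀ β, edgePart p β e = 0) ∧ (∀ β, edgePart c₂ β e = 0)) ∨
    ((∀ β, edgePart c₁ β e = 0) ∧ (∀ β, edgePart c₂ β e = 0)) ∨
    ((∀ β, edgePart c₁ β e = 0) ∧ (∀ β, edgePart p β e = 0)) := by
  by_cases h1 : (e : Sym2 V) ∈ c₁.edges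
  · exact Or.inl ⟨edgePart_eq_zero (edges_disjoint
      (fun x hx hx' => h.inter₁ x hx' hx) h1), edgePart_eq_zero (edges_disjoint
      (fun x hx hx' => (h.inter x hx hx').1) h1)⟩
  · by_cases h2 : (e : Sym2 V) ∈ p.edges
    · exact Or.inr (Or.inl ⟨edgePart_eq_zero h1, edgePart_eq_zero (edges_disjoint h.inter₂ h2)⟩)
    · exact Or.inr (Or.inr ⟨edgePart_eq_zero h1, edgePart_eq_zero h2⟩)

/-- The edges of a dumbbell. -/
def dumbbellEdges (c₁ : G.Walk a a) (p : G.Walk a b) (c₂ : G.Walk b b) : Set (Sym2 V) :=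
  {e | e ∈ c₁.edges ∨ e ∈ p.edges ∨ e ∈ c₂.edges}

variable [Fintype V]

theorem IsDumbbell.generatesKernelOn (h : IsDumbbell c₁ p c₂) :
    GeneratesKernelOn (edgeMatrix G) {e | (e : Sym2 V) ∈ dumbbellEdges c₁ p c₂}
      (edgePart (dumbbellWalk c₁ p c₂) true) (edgePart (dumbbellWalk c₁ p c₂) false) := by
  have hnil : ¬ c₁.Nil := h.odd₁.1.not_nil
  refine generatesKernelOn_of_unique (multidegree_edgePart_closed
    (even_length_dumbbellWalk h.odd₁.2 h.odd₂.2)) (fun e => ?_) (fun e he => ?_)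
    (c₁.adj_snd hnil) ?_ fun w hw hS h0 => hw.eq_zero_of_isDumbbell h hS h0
  · rw [edgePart_dumbbellWalk h.odd₁.2 h.odd₂.2, edgePart_dumbbellWalk h.odd₁.2 h.odd₂.2]
    have h1 := edgePart_le_one h.odd₁.1.isTrail e
    have h2 := edgePart_le_one h.odd₂.1.isTrail e
    have h3 := edgePart_le_one h.isPath.isTrail e
    rcases h.edgePart_cases e with h4 | h4 | h4 <;> by_cases hp : Even p.length <;>
      simp [hp, h4.1, h4.2] <;> omega
  · by_contra hn
    simp only [dumbbellEdges, Set.mem_ofPred_eq, not_or] at hn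
    rw [edgePart_dumbbellWalk h.odd₁.2 h.odd₂.2, edgePart_dumbbellWalk h.odd₁.2 h.odd₂.2] at he
    simp [edgePart_eq_zero hn.1, edgePart_eq_zero hn.2.1, edgePart_eq_zero hn.2.2] at he
  · have h1 := one_le_edgePart_snd hnil
    have h2 := edgePart_le_one h.odd₁.1.isTrail ⟨s(a, c₁.snd), c₁.adj_snd hnil⟩
    rw [edgePart_dumbbellWalk h.odd₁.2 h.odd₂.2]
    rcases h.edgePart_cases ⟨s(a, c₁.snd), c₁.adj_snd hnil⟩ with h4 | h4 | h4
    · simp only [Finsupp.add_apply, h4.1, h4.2]; omega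
    · rw [h4.1] at h1; omega
    · rw [h4.1] at h1; omega

theorem generatesKernelOn_of_isCycle {c : G.Walk a a} (hc : c.IsCycle) (he : Even c.length) :
    GeneratesKernelOn (edgeMatrix G) {e | (e : Sym2 V) ∈ {e | e ∈ c.edges}}
      (edgePart c true) (edgePart c false) := by
  have hnil : ¬ c.Nil := hc.not_nil
  refine generatesKernelOn_of_unique (multidegree_edgePart_closed he) (fun e => ?_) (fun e he => ?_)
    (c.adj_snd hnil) ?_ fun w hw hS h0 s t => ?_
  · have := edgePart_le_one hc.isTrail e
    omega
  · rcases he with he | he <;> exact mem_edges_of_edgePart_ne_zero he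
  · have h1 := one_le_edgePart_snd hnil
    have h2 := edgePart_le_one hc.isTrail ⟨s(a, c.snd), c.adj_snd hnil⟩
    omega
  · by_contra hne
    exact hne (hw.eq_zero_of_isCycle hc (fun z _ _ t ht => hS z t ht) h0 (hS s t hne))

variable (K : Type*) [Field K]

theorem sfCircuits_of_isCycle {c : G.Walk a a} (hc : c.IsCycle) (he : Even c.length) :
    monomial (edgePart c true) (1 : K) - monomial (edgePart c false) 1 ∈
      sfCircuits K (edgeMatrix G) :=
  ⟨(generatesKernelOn_of_isCycle hc he).mem_circuits, _, _, rfl, Or.inl <|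
    squarefree_monomial fun e => by have := edgePart_le_one hc.isTrail e; omega⟩

theorem IsDumbbell.mem_circuits (h : IsDumbbell c₁ p c₂) :
    monomial (edgePart (dumbbellWalk c₁ p c₂) true) (1 : K) -
      monomial (edgePart (dumbbellWalk c₁ p c₂) false) 1 ∈ circuits K (edgeMatrix G) :=
  h.generatesKernelOn.mem_circuits

/-- At most one edge is doubled, and it occurs only in the second monomial. -/
theorem IsDumbbell.mem_sfCircuits (h : IsDumbbell c₁ p c₂) (hp : p.length ≤ 1) :
    monomial (edgePart (dumbbellWalk c₁ p c₂) true) (1 : K) -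
      monomial (edgePart (dumbbellWalk c₁ p c₂) false) 1 ∈ sfCircuits K (edgeMatrix G) := by
  refine ⟨h.mem_circuits K, _, _, rfl, Or.inl <| squarefree_monomial fun e => ?_⟩
  have h0 : edgePart p false = 0 := by
    have := (degree_edgePart p).2
    exact (Finsupp.degree_eq_zero_iff _).1 (by omega)
  rw [edgePart_dumbbellWalk h.odd₁.2 h.odd₂.2, Bool.not_true, h0]
  have h1 := edgePart_le_one h.odd₁.1.isTrail e
  have h2 := edgePart_le_one h.odd₂.1.isTrail e
  rcases h.edgePart_cases e with h4 | h4 | h4 <;> by_cases hp : Even p.length <;>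
    simp [hp, h4.1, h4.2] <;> omega

/-- Consecutive path edges fall into different monomials, so each monomial contains a square. -/
theorem IsDumbbell.notMem_sfCircuits (h : IsDumbbell c₁ p c₂) (hp : 2 ≤ p.length) :
    monomial (edgePart (dumbbellWalk c₁ p c₂) true) (1 : K) -
      monomial (edgePart (dumbbellWalk c₁ p c₂) false) 1 ∉ sfCircuits K (edgeMatrix G) := by
  obtain ⟨e, he⟩ := exists_edgePart_ne_zero hp true
  obtain ⟨f, hf⟩ := exists_edgePart_ne_zero hp false
  refine ToricCircuits.notMem_sfCircuits (i := f) (j := e) h.generatesKernelOn.ne ?_ ?_ <;>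
  · rw [edgePart_dumbbellWalk h.odd₁.2 h.odd₂.2]
    simp only [Bool.not_true, Bool.not_false, Finsupp.add_apply]
    omega

theorem mem_support_of_multidegree_edgePart_ne_zero {q : G.Walk x y} {β : Bool} {z : V}
    (h : multidegree (edgeMatrix G) (edgePart q β) z ≠ 0) : z ∈ q.support := by
  obtain ⟨t, hzt, u', hu⟩ := exists_edge_of_multidegree_ne_zero h
  have he : edgePart q β ⟨s(z, t), hzt⟩ ≠ 0 := by simp [hu]
  exact q.fst_mem_support_of_mem_edges (mem_edges_of_edgePart_ne_zero he)

/-- The columns allowed in `IsFundamental` are edges with both ends on the dumbbell; inducedness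
makes them dumbbell edges. -/
theorem IsDumbbell.isFundamental (h : IsDumbbell c₁ p c₂)
    (hind : (c₁.toSubgraph ⊔ p.toSubgraph ⊔ c₂.toSubgraph).IsInduced) :
    IsFundamental (edgeMatrix G) (monomial (edgePart (dumbbellWalk c₁ p c₂) true) (1 : K) -
      monomial (edgePart (dumbbellWalk c₁ p c₂) false) 1) := by
  refine h.generatesKernelOn.isFundamental ?_
  rintro ⟨e, he⟩ hmem
  induction e with
  | _ s t =>
  rw [mem_columnsIn] at hmem
  have hsupp : ∀ z, z ∈ s(s, t) → z ∈ (c₁.toSubgraph ⊔ p.toSubgraph ⊔ c₂.toSubgraph).verts := by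
    intro z hz
    have h1 := hmem z (by simp [edgeMatrix, hz])
    rw [mem_dividingVars] at h1
    have h2 := mem_support_of_multidegree_edgePart_ne_zero h1
    simp only [dumbbellWalk, Walk.mem_support_append_iff, Walk.support_reverse,
      List.mem_reverse] at h2
    simp only [Subgraph.verts_sup, Walk.verts_toSubgraph, Set.mem_union, Set.mem_ofPred_eq]
    tauto
  have hadj := hind (hsupp s (Sym2.mem_mk_left _ _)) (hsupp t (Sym2.mem_mk_right _ _)) he
  simp only [Subgraph.sup_adj, Walk.adj_toSubgraph_iff_mem_edges] at hadj
  change s(s, t) ∈ c₁.edges ∨ s(s, t) ∈ p.edges ∨ s(s, t) ∈ c₂.edges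
  tauto

theorem HasInducedLongDumbbell.exists_isFundamental (h : HasInducedLongDumbbell G) :
    ∃ f ∈ circuits K (edgeMatrix G) \ sfCircuits K (edgeMatrix G),
      IsFundamental (edgeMatrix G) f := by
  obtain ⟨a, b, c₁, c₂, p, h1, h2, hp, hp2, h12, hp1, hpc, hind⟩ := h
  have hD : IsDumbbell c₁ p c₂ := ⟨h1, h2, hp, fun x hx hx' => absurd hx' (h12 x hx), hp1, hpc⟩
  exact ⟨_, ⟨hD.mem_circuits K, hD.notMem_sfCircuits K hp2⟩, hD.isFundamental K hind⟩

end CircuitWalks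

end

end ToricCircuits

namespace ToricCircuits

open SimpleGraph

noncomputable section

/-! ### Shortest lollipops and induced dumbbells -/

section Lollipop

variable {V : Type*} {G : SimpleGraph V} {a b x y t : V}

theorem mem_edges_of_length_eq_one {p : G.Walk x y} (hp : p.length = 1) : s(x, y) ∈ p.edges := by
  cases p with
  | nil => simp at hp
  | cons h q =>
    cases q with
    | nil => simp
    | cons h' q => simp at hp

theorem Walk.three_le_length_of_odd {p : G.Walk x x} (hp : Odd p.length) : 3 ≤ p.length := by
  have h1 : p.length ≠ 1 := fun h => (p.adj_of_mem_edges (mem_edges_of_length_eq_one h)).ne rfl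
  obtain ⟨k, hk⟩ := hp
  omega

theorem exists_append_of_not_isPath {p : G.Walk x y} (hp : ¬ p.IsPath) :
    ∃ (z : V) (p₁ : G.Walk x z) (p₂ : G.Walk z z) (p₃ : G.Walk z y),
      p = p₁.append (p₂.append p₃) ∧ p₂.length ≠ 0 := by
  rw [Walk.isPath_iff_isSubwalk_imp_nil] at hp
  push Not at hp
  obtain ⟨z, q, ⟨p₁, p₃, hq⟩, hnil⟩ := hp
  refine ⟨z, p₁, q, p₃, by rw [hq, Walk.append_assoc], ?_⟩
  rwa [Ne, Walk.length_eq_zero_iff]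

theorem exists_append_of_not_isCycle {p : G.Walk x x} (hp : ¬ p.IsCycle) (h3 : 3 ≤ p.length) :
    ∃ (z : V) (p₁ : G.Walk x z) (p₂ : G.Walk z z) (p₃ : G.Walk z x),
      p = p₁.append (p₂.append p₃) ∧ p₁.length ≠ 0 ∧ p₂.length ≠ 0 := by
  rw [Walk.isCycle_iff_isPath_tail_and_le_length, not_and'] at hp
  have hp' := hp h3
  cases p with
  | nil => simp at h3
  | cons h p =>
    have hp'' : ¬ p.IsPath := fun h' => hp' (by simpa using h')
    obtain ⟨z, p₁, p₂, p₃, rfl, hne⟩ := exists_append_of_not_isPath hp''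
    exact ⟨z, .cons h p₁, p₂, p₃, rfl, by simp, hne⟩

/-- An odd closed walk `c` in `T` together with a walk `r` in `U` from a vertex of `c` to `t`, of
minimal total length. -/
structure IsLollipop (U T : Set V) (c : G.Walk a a) (r : G.Walk a t) : Prop where
  odd : Odd c.length
  support_fst : ∀ x ∈ c.support, x ∈ T
  support_snd : ∀ x ∈ r.support, x ∈ U
  min : ∀ (a' : V) (c' : G.Walk a' a') (r' : G.Walk a' t), Odd c'.length →
    (∀ x ∈ c'.support, x ∈ T) → (∀ x ∈ r'.support, x ∈ U) →
    c.length + r.length ≤ c'.length + r'.length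

theorem exists_isLollipop {U T : Set V} (c : G.Walk a a) (r : G.Walk a t) (hc : Odd c.length)
    (hcT : ∀ x ∈ c.support, x ∈ T) (hrU : ∀ x ∈ r.support, x ∈ U) :
    ∃ (a' : V) (c' : G.Walk a' a') (r' : G.Walk a' t), IsLollipop U T c' r' := by
  classical
  have hex : ∃ (n : ℕ) (a' : V) (c' : G.Walk a' a') (r' : G.Walk a' t), Odd c'.length ∧
    (∀ x ∈ c'.support, x ∈ T) ∧ (∀ x ∈ r'.support, x ∈ U) ∧ c'.length + r'.length = n :=
    ⟨_, a, c, r, hc, hcT, hrU, rfl⟩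
  obtain ⟨a', c', r', h1, h2, h3, h4⟩ := Nat.find_spec hex
  exact ⟨a', c', r', h1, h2, h3, fun a'' c'' r'' h5 h6 h7 =>
    h4.le.trans (Nat.find_min' hex ⟨a'', c'', r'', h5, h6, h7, rfl⟩)⟩

variable {U T : Set V} {c : G.Walk a a} {r : G.Walk a t}

theorem IsLollipop.isPath (h : IsLollipop U T c r) : r.IsPath := by
  classical
  have h1 := h.min a c r.bypass h.odd h.support_fst
    fun x hx => h.support_snd x (r.support_bypass_subset_support hx)
  rw [← r.bypass_eq_self_of_length_le_length_bypass (by omega)]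
  exact r.bypass_isPath

/-- At a repeated vertex a closed part splits off: if odd, it replaces `c` and part of the rest
extends `r`; if even, it can be deleted. Both shorten the lollipop. -/
theorem IsLollipop.isCycle (h : IsLollipop U T c r) (hTU : T ⊆ U) : c.IsCycle := by
  by_contra hcon
  obtain ⟨z, p₁, p₂, p₃, rfl, hp₁, hp₂⟩ :=
    exists_append_of_not_isCycle hcon (Walk.three_le_length_of_odd h.odd)
  have hT := h.support_fst
  have hU := h.support_snd
  have ho := h.odd
  simp only [Walk.mem_support_append_iff] at hT
  simp only [Walk.length_append] at ho
  by_cases ho' : Odd p₂.length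
  · have := h.min z p₂ (p₃.append r) ho' (fun x hx => hT x (by tauto)) (fun x hx => by
      rw [Walk.mem_support_append_iff] at hx
      exact hx.elim (fun hx => hTU (hT x (by tauto))) (hU x))
    simp only [Walk.length_append] at this
    omega
  · have := h.min a (p₁.append p₃) r (by rw [Walk.length_append]; grind) (fun x hx => by
      rw [Walk.mem_support_append_iff] at hx
      exact hT x (by tauto)) hU
    simp only [Walk.length_append] at this
    omega

theorem IsLollipop.inter (h : IsLollipop U T c r) (hx : x ∈ r.support) (hx' : x ∈ c.support) :
    x = a := by
  obtain ⟨r₁, r₂, rfl⟩ := Walk.mem_support_iff_exists_append.1 hx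
  obtain ⟨c₁, c₂, rfl⟩ := Walk.mem_support_iff_exists_append.1 hx'
  have hT := h.support_fst
  have hU := h.support_snd
  have ho := h.odd
  simp only [Walk.mem_support_append_iff] at hT hU
  simp only [Walk.length_append] at ho
  have := h.min x (c₂.append c₁) r₂ (by rwa [Walk.length_append, add_comm]) (fun x hx => by
    rw [Walk.mem_support_append_iff] at hx
    exact hT x (by tauto)) (fun x hx => hU x (by tauto))
  simp only [Walk.length_append] at this
  exact (Walk.eq_of_length_eq_zero (p := r₁) (by omega)).symm

/-- If `c₂` is odd, the chord replaces it. If `c₂` is even, the chord closes it to an odd walk,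
reachable from `r` through `c₁` or through `c₃`; minimality then bounds both lengths by 1, and their
sum is odd. -/
theorem IsLollipop.mem_edges_of_append {c₁ : G.Walk a x} {c₂ : G.Walk x y} {c₃ : G.Walk y a}
    (h : IsLollipop U T (c₁.append (c₂.append c₃)) r) (hTU : T ⊆ U) (hxy : G.Adj x y) :
    s(x, y) ∈ (c₁.append (c₂.append c₃)).edges := by
  have hT := h.support_fst
  have hU := h.support_snd
  have ho := h.odd
  simp only [Walk.mem_support_append_iff] at hT
  simp only [Walk.length_append] at ho
  simp only [Walk.edges_append, List.mem_append]
  by_cases h1 : c₂.length = 1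
  · exact Or.inr (Or.inl (mem_edges_of_length_eq_one h1))
  by_cases h2 : c₃.length + c₁.length = 1
  · have := mem_edges_of_length_eq_one (p := c₃.append c₁) (by rwa [Walk.length_append])
    rw [Walk.edges_append, List.mem_append, Sym2.eq_swap] at this
    tauto
  exfalso
  by_cases ho' : Odd c₂.length
  · have := h.min a (c₁.append (.cons hxy c₃)) r (by
      rw [Walk.length_append, Walk.length_cons]; grind) (fun z hz => by
      rw [Walk.mem_support_append_iff, Walk.support_cons, List.mem_cons] at hz
      rcases hz with hz | rfl | hz
      · exact hT z (by tauto)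
      · exact hT z (Or.inl c₁.end_mem_support)
      · exact hT z (by tauto)) hU
    simp only [Walk.length_append, Walk.length_cons] at this
    grind
  · have h3 := h.min x (.cons hxy c₂.reverse) (c₁.reverse.append r) (by
      rw [Walk.length_cons, Walk.length_reverse]; grind) (fun z hz => by
      rw [Walk.support_cons, List.mem_cons, Walk.support_reverse, List.mem_reverse] at hz
      rcases hz with rfl | hz
      · exact hT z (Or.inl c₁.end_mem_support)
      · exact hT z (by tauto)) (fun z hz => by
      rw [Walk.mem_support_append_iff, Walk.support_reverse, List.mem_reverse] at hz
      exact hz.elim (fun hz => hTU (hT z (by tauto))) (hU z))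
    have h4 := h.min y (.cons hxy.symm c₂) (c₃.append r) (by
      rw [Walk.length_cons]; grind) (fun z hz => by
      rw [Walk.support_cons, List.mem_cons] at hz
      rcases hz with rfl | hz
      · exact hT z (Or.inr (Or.inl c₂.end_mem_support))
      · exact hT z (by tauto)) (fun z hz => by
      rw [Walk.mem_support_append_iff] at hz
      exact hz.elim (fun hz => hTU (hT z (by tauto))) (hU z))
    simp only [Walk.length_append, Walk.length_cons, Walk.length_reverse] at h3 h4
    grind

theorem IsLollipop.mem_edges_fst (h : IsLollipop U T c r) (hTU : T ⊆ U) (hx : x ∈ c.support)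
    (hy : y ∈ c.support) (hxy : G.Adj x y) : s(x, y) ∈ c.edges := by
  obtain ⟨c₁, c₂, rfl⟩ := Walk.mem_support_iff_exists_append.1 hx
  rw [Walk.mem_support_append_iff] at hy
  rcases hy with hy | hy
  · obtain ⟨c₃, c₄, rfl⟩ := Walk.mem_support_iff_exists_append.1 hy
    rw [← Walk.append_assoc] at h ⊢
    rw [Sym2.eq_swap]
    exact h.mem_edges_of_append hTU hxy.symm
  · obtain ⟨c₃, c₄, rfl⟩ := Walk.mem_support_iff_exists_append.1 hy
    exact h.mem_edges_of_append hTU hxy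

theorem IsLollipop.mem_edges_snd_of_append {r₁ : G.Walk a x} {r₂ : G.Walk x y} {r₃ : G.Walk y t}
    (h : IsLollipop U T c (r₁.append (r₂.append r₃))) (hxy : G.Adj x y) :
    s(x, y) ∈ (r₁.append (r₂.append r₃)).edges := by
  have hU := h.support_snd
  simp only [Walk.mem_support_append_iff] at hU
  have := h.min a c (r₁.append (.cons hxy r₃)) h.odd h.support_fst (fun z hz => by
    rw [Walk.mem_support_append_iff, Walk.support_cons, List.mem_cons] at hz
    rcases hz with hz | rfl | hz
    · exact hU z (by tauto)
    · exact hU z (Or.inl r₁.end_mem_support)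
    · exact hU z (by tauto))
  simp only [Walk.length_append, Walk.length_cons] at this
  have h0 : r₂.length ≠ 0 := fun h0 => hxy.ne (Walk.eq_of_length_eq_zero h0)
  have := mem_edges_of_length_eq_one (p := r₂) (by omega)
  simp only [Walk.edges_append, List.mem_append]
  tauto

theorem IsLollipop.mem_edges_snd (h : IsLollipop U T c r) (hx : x ∈ r.support)
    (hy : y ∈ r.support) (hxy : G.Adj x y) : s(x, y) ∈ r.edges := by
  obtain ⟨c₁, c₂, rfl⟩ := Walk.mem_support_iff_exists_append.1 hx
  rw [Walk.mem_support_append_iff] at hy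
  rcases hy with hy | hy
  · obtain ⟨c₃, c₄, rfl⟩ := Walk.mem_support_iff_exists_append.1 hy
    rw [← Walk.append_assoc] at h ⊢
    rw [Sym2.eq_swap]
    exact h.mem_edges_snd_of_append hxy.symm
  · obtain ⟨c₃, c₄, rfl⟩ := Walk.mem_support_iff_exists_append.1 hy
    exact h.mem_edges_snd_of_append hxy

/-- Jumping from `x` to `y` is shorter unless `y` is the second vertex of `r`. Then `y` has the two
neighbours `a` and `x` in `T`, so `y ∈ T`, and closing the odd arc of `c` between `a` and `x`
through `y` gives a shorter lollipop. -/
theorem IsLollipop.eq_of_adj (h : IsLollipop U T c r) (hTU : T ⊆ U)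
    (hT' : ∀ y ∈ U, ∀ x ∈ T, ∀ x' ∈ T, x ≠ x' → G.Adj y x → G.Adj y x' → y ∈ T)
    (hx : x ∈ c.support) (hy : y ∈ r.support) (hxy : G.Adj x y) : x = a ∨ y = a := by
  by_contra! hne
  obtain ⟨hxa, hya⟩ := hne
  obtain ⟨c₁, c₂, rfl⟩ := Walk.mem_support_iff_exists_append.1 hx
  obtain ⟨r₁, r₂, rfl⟩ := Walk.mem_support_iff_exists_append.1 hy
  have hT := h.support_fst
  have hU := h.support_snd
  have ho := h.odd
  simp only [Walk.mem_support_append_iff] at hT hU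
  simp only [Walk.length_append] at ho
  have hr₁ : r₁.length ≠ 0 := fun h0 => hya (Walk.eq_of_length_eq_zero h0).symm
  have hc₁ : c₁.length ≠ 0 := fun h0 => hxa (Walk.eq_of_length_eq_zero h0).symm
  have hc₂ : c₂.length ≠ 0 := fun h0 => hxa (Walk.eq_of_length_eq_zero h0)
  have h1 := h.min x (c₂.append c₁) (.cons hxy r₂) (by rwa [Walk.length_append, add_comm])
    (fun z hz => by
      rw [Walk.mem_support_append_iff] at hz
      exact hT z (by tauto)) (fun z hz => by
      rw [Walk.support_cons, List.mem_cons] at hz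
      rcases hz with rfl | hz
      · exact hTU (hT z (Or.inl c₁.end_mem_support))
      · exact hU z (by tauto))
  simp only [Walk.length_append, Walk.length_cons] at h1
  have hay : G.Adj a y := r₁.adj_of_mem_edges (mem_edges_of_length_eq_one (by omega))
  have hyT : y ∈ T := hT' y (hU y (Or.inl r₁.end_mem_support)) x (hT x (Or.inl c₁.end_mem_support))
    a (hT a (Or.inl c₁.start_mem_support)) hxa hxy.symm hay.symm
  have hU₂ : ∀ z ∈ r₂.support, z ∈ U := fun z hz => hU z (by tauto)
  by_cases ho' : Odd c₁.length
  · have h2 := h.min y (.cons hay.symm (c₁.append (.cons hxy .nil))) r₂ (by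
      simp only [Walk.length_cons, Walk.length_append, Walk.length_nil]; grind) (fun z hz => by
      simp only [Walk.support_cons, List.mem_cons, Walk.mem_support_append_iff,
        Walk.support_nil, List.not_mem_nil, or_false] at hz
      rcases hz with rfl | hz | rfl | rfl
      · exact hyT
      · exact hT z (by tauto)
      · exact hT z (Or.inl c₁.end_mem_support)
      · exact hyT) hU₂
    simp only [Walk.length_append, Walk.length_cons, Walk.length_nil] at h2
    grind
  · have h2 := h.min y (.cons hxy.symm (c₂.append (.cons hay .nil))) r₂ (by
      simp only [Walk.length_cons, Walk.length_append, Walk.length_nil]; grind) (fun z hz => by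
      simp only [Walk.support_cons, List.mem_cons, Walk.mem_support_append_iff,
        Walk.support_nil, List.not_mem_nil, or_false] at hz
      rcases hz with rfl | hz | rfl | rfl
      · exact hyT
      · exact hT z (by tauto)
      · exact hT z (Or.inl c₁.start_mem_support)
      · exact hyT) hU₂
    simp only [Walk.length_append, Walk.length_cons, Walk.length_nil] at h2
    grind

theorem IsLollipop.mem_edges (h : IsLollipop U T c r) (hTU : T ⊆ U)
    (hT' : ∀ y ∈ U, ∀ x ∈ T, ∀ x' ∈ T, x ≠ x' → G.Adj y x → G.Adj y x' → y ∈ T)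
    (hx : x ∈ c.support ∨ x ∈ r.support) (hy : y ∈ c.support ∨ y ∈ r.support)
    (hxy : G.Adj x y) : s(x, y) ∈ c.edges ∨ s(x, y) ∈ r.edges := by
  rcases hx with hx | hx <;> rcases hy with hy | hy
  · exact Or.inl (h.mem_edges_fst hTU hx hy hxy)
  · rcases h.eq_of_adj hTU hT' hx hy hxy with rfl | rfl
    · exact Or.inr (h.mem_edges_snd r.start_mem_support hy hxy)
    · exact Or.inl (h.mem_edges_fst hTU hx c.start_mem_support hxy)
  · rcases h.eq_of_adj hTU hT' hy hx hxy.symm with rfl | rfl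
    · exact Or.inr (h.mem_edges_snd hx r.start_mem_support hxy)
    · exact Or.inl (h.mem_edges_fst hTU c.start_mem_support hy hxy)
  · exact Or.inr (h.mem_edges_snd hx hy hxy)

theorem isPath_append_of_inter {p : G.Walk x y} {q : G.Walk y t} (hp : p.IsPath) (hq : q.IsPath)
    (h : ∀ z ∈ p.support, z ∈ q.support → z = y) : (p.append q).IsPath := by
  rw [Walk.isPath_def, Walk.support_append]
  have hq' := (Walk.isPath_def _).1 hq
  rw [← Walk.cons_tail_support, List.nodup_cons] at hq'
  refine List.Nodup.append ((Walk.isPath_def _).1 hp) hq'.2 ?_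
  intro z hz hz'
  have := h z hz (List.mem_of_mem_tail hz')
  subst this
  exact hq'.1 hz'

/-- Two shortest lollipops ending at `b`, one in `T₁ ∪ P` and one in `T₂`, are glued at `b`. Their
cycles may have base points other than `a` and `b`, but `T₁` and `T₂` are disjoint without edges
between them, so the connecting path has length at least 2. -/
theorem hasInducedLongDumbbell_of_separated {T₁ T₂ P : Set V} {c₁ : G.Walk a a} {c₂ : G.Walk b b}
    {p : G.Walk a b} (h₁ : Odd c₁.length) (h₂ : Odd c₂.length) (hc₁ : ∀ x ∈ c₁.support, x ∈ T₁)
    (hc₂ : ∀ x ∈ c₂.support, x ∈ T₂) (hp : ∀ x ∈ p.support, x ∈ P)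
    (sep₁ : ∀ x ∈ T₁, x ≠ a → ∀ y ∈ P ∪ T₂, y ≠ a → ¬ G.Adj x y ∧ x ≠ y)
    (sep₂ : ∀ x ∈ T₂, x ≠ b → ∀ y ∈ P ∪ T₁, y ≠ b → ¬ G.Adj x y ∧ x ≠ y)
    (hab : a ≠ b) (hadj : ¬ G.Adj a b) : HasInducedLongDumbbell G := by
  have haT : a ∈ T₁ := hc₁ a c₁.start_mem_support
  have hbT : b ∈ T₂ := hc₂ b c₂.start_mem_support
  have sep : ∀ x ∈ T₁, ∀ y ∈ T₂, ¬ G.Adj x y ∧ x ≠ y := by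
    intro x hx y hy
    by_cases hyb : y = b
    · by_cases hxa : x = a
      · rw [hyb, hxa]; exact ⟨hadj, hab⟩
      · exact sep₁ x hx hxa y (Or.inr hy) (by rw [hyb]; exact hab.symm)
    · by_cases hxb : x = b
      · by_cases hya : y = a
        · exact absurd rfl (sep₂ y hy hyb y (Or.inr (hya ▸ haT)) hyb).2
        · exact absurd rfl (sep₁ x hx (hxb ▸ hab.symm) x (Or.inr (hxb ▸ hbT))
            (hxb ▸ hab.symm)).2
      · have := sep₂ y hy hyb x (Or.inr hx) hxb
        exact ⟨fun h => this.1 h.symm, this.2.symm⟩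
  have sepb : ∀ x ∈ T₁ ∪ P, x ∈ T₂ → x = b := by
    intro x hx hx2
    by_contra hxb
    exact (sep₂ x hx2 hxb x hx.symm hxb).2 rfl
  have hT₁ : ∀ y ∈ T₁ ∪ P, ∀ x ∈ T₁, ∀ x' ∈ T₁, x ≠ x' → G.Adj y x → G.Adj y x' → y ∈ T₁ := by
    rintro y (hy | hy) x hx x' hx' hne hyx hyx'
    · exact hy
    · by_cases hya : y = a
      · exact hya ▸ haT
      · by_cases hxa : x = a
        · exact absurd hyx'.symm (sep₁ x' hx' (hxa ▸ hne.symm) y (Or.inl hy) hya).1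
        · exact absurd hyx.symm (sep₁ x hx hxa y (Or.inl hy) hya).1
  obtain ⟨a', c, r, hL⟩ := exists_isLollipop (U := T₁ ∪ P) (T := T₁) c₁ p h₁ hc₁
    fun x hx => Or.inr (hp x hx)
  obtain ⟨b', c', r', hL'⟩ := exists_isLollipop (U := T₂) (T := T₂) c₂ (.nil : G.Walk b b) h₂ hc₂
    (by simpa using hbT)
  have ha' : a' ∈ T₁ := hL.support_fst a' c.start_mem_support
  have hb' : b' ∈ T₂ := hL'.support_fst b' c'.start_mem_support
  have hmem : ∀ x, x ∈ c.support ∨ x ∈ r.support → x ∈ T₁ ∪ P := fun x hx =>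
    hx.elim (fun hx => Or.inl (hL.support_fst x hx)) (hL.support_snd x)
  have hmem' : ∀ x, x ∈ c'.support ∨ x ∈ r'.support → x ∈ T₂ := fun x hx =>
    hx.elim (hL'.support_fst x) (hL'.support_snd x)
  -- By `sep₂` an edge between the two lollipops ends at `b`, which lies on both; so it is an edge
  -- inside one of them.
  have cross : ∀ x y, (x ∈ c.support ∨ x ∈ r.support) → (y ∈ c'.support ∨ y ∈ r'.support) →
      G.Adj x y → s(x, y) ∈ c.edges ∨ s(x, y) ∈ r.edges ∨ s(x, y) ∈ r'.edges ∨
        s(x, y) ∈ c'.edges := by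
    intro x y hx hy hxy
    by_cases hyb : y = b
    · subst hyb
      have := hL.mem_edges Set.subset_union_left hT₁ hx (Or.inr r.end_mem_support) hxy
      tauto
    · by_cases hxb : x = b
      · subst hxb
        have := hL'.mem_edges subset_rfl (fun y hy _ _ _ _ _ _ _ => hy)
          (Or.inr r'.end_mem_support) hy hxy
        tauto
      · exact absurd hxy.symm (sep₂ y (hmem' y hy) hyb x (hmem x hx).symm hxb).1
  refine ⟨a', b', c, c', r.append r'.reverse, ⟨hL.isCycle Set.subset_union_left, hL.odd⟩,
    ⟨hL'.isCycle subset_rfl, hL'.odd⟩, ?_, ?_, ?_, ?_, ?_, ?_⟩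
  · refine isPath_append_of_inter hL.isPath hL'.isPath.reverse fun z hz hz' => ?_
    rw [Walk.support_reverse, List.mem_reverse] at hz'
    exact sepb z (hmem z (Or.inr hz)) (hmem' z (Or.inr hz'))
  · by_contra! hlt
    have h := sep a' ha' b' hb'
    by_cases h0 : (r.append r'.reverse).length = 0
    · exact h.2 (Walk.eq_of_length_eq_zero h0)
    · exact h.1 (Walk.adj_of_mem_edges _ (mem_edges_of_length_eq_one
        (p := r.append r'.reverse) (by omega)))
  · exact fun x hx hx' => (sep x (hL.support_fst x hx) x (hL'.support_fst x hx')).2 rfl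
  · intro x hx hx'
    rw [Walk.mem_support_append_iff, Walk.support_reverse, List.mem_reverse] at hx
    rcases hx with hx | hx
    · exact hL.inter hx hx'
    · exact absurd rfl (sep x (hL.support_fst x hx') x (hL'.support_snd x hx)).2
  · intro x hx hx'
    rw [Walk.mem_support_append_iff, Walk.support_reverse, List.mem_reverse] at hx
    rcases hx with hx | hx
    · have := sepb x (hmem x (Or.inr hx)) (hL'.support_fst x hx')
      subst this
      exact hL'.inter r'.end_mem_support hx'
    · exact hL'.inter hx hx'
  · intro x hx y hy hxy
    simp only [Subgraph.verts_sup, Walk.verts_toSubgraph, Set.mem_union, Set.mem_ofPred_eq,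
      Walk.mem_support_append_iff, Walk.support_reverse, List.mem_reverse] at hx hy
    simp only [Subgraph.sup_adj, Walk.adj_toSubgraph_iff_mem_edges, Walk.edges_append,
      Walk.edges_reverse, List.mem_append, List.mem_reverse]
    have hx' : (x ∈ c.support ∨ x ∈ r.support) ∨ (x ∈ c'.support ∨ x ∈ r'.support) := by tauto
    have hy' : (y ∈ c.support ∨ y ∈ r.support) ∨ (y ∈ c'.support ∨ y ∈ r'.support) := by tauto
    clear hx hy
    rcases hx' with hx' | hx' <;> rcases hy' with hy' | hy'
    · rcases hL.mem_edges Set.subset_union_left hT₁ hx' hy' hxy with h | h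
      · exact Or.inl (Or.inl h)
      · exact Or.inl (Or.inr (Or.inl h))
    · rcases cross x y hx' hy' hxy with h | h | h | h
      · exact Or.inl (Or.inl h)
      · exact Or.inl (Or.inr (Or.inl h))
      · exact Or.inl (Or.inr (Or.inr h))
      · exact Or.inr h
    · rw [Sym2.eq_swap]
      rcases cross y x hy' hx' hxy.symm with h | h | h | h
      · exact Or.inl (Or.inl h)
      · exact Or.inl (Or.inr (Or.inl h))
      · exact Or.inl (Or.inr (Or.inr h))
      · exact Or.inr h
    · rcases hL'.mem_edges subset_rfl (fun y hy _ _ _ _ _ _ _ => hy) hx' hy' hxy with h | h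
      · exact Or.inr h
      · exact Or.inl (Or.inr (Or.inr h))

end Lollipop

end

end ToricCircuits

namespace ToricCircuits

open SimpleGraph MvPolynomial

noncomputable section

/-! ### Obstructions contain induced long dumbbells -/

section Core

variable {V : Type*} {G : SimpleGraph V} {a b x y : V} {c : AddCon (G.edgeSet →₀ ℕ)} {d : ℕ}

theorem IsObstruction.three_le_length {p : G.Walk x x} (h : IsObstruction c d p) :
    3 ≤ p.length := by
  obtain ⟨h1, h2⟩ := h
  by_contra! hlt
  refine h2 ?_
  have hE : Even p.length := by rw [h1]; exact even_two_mul d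
  cases p with
  | nil => exact c.refl _
  | @cons _ z _ h p =>
    cases p with
    | nil => simp at hE
    | cons h' q =>
      cases q with
      | nil =>
        have : (⟨s(z, x), h'⟩ : G.edgeSet) = ⟨s(x, z), h⟩ := Subtype.ext Sym2.eq_swap
        simp only [edgePart_cons, this]
        simpa using c.refl _
      | cons h'' q => simp only [Walk.length_cons] at hlt; omega

theorem eq_reverse_of_length_eq_one {p : G.Walk a b} {q : G.Walk b a} (hp : p.length = 1)
    (hq : q.length = 1) : q = p.reverse := by
  cases p with
  | nil => simp at hp
  | cons h p =>
    cases p with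
    | cons h' p => simp at hp
    | nil =>
      cases q with
      | nil => simp at hq
      | cons h q =>
        cases q with
        | cons h' q => simp at hq
        | nil => rfl

variable [Fintype V] (K : Type*) [Field K]

/-- An obstruction whose binomial is not a circuit with a squarefree monomial. -/
def IsNonSfObstruction (c : AddCon (G.edgeSet →₀ ℕ)) (d : ℕ) (p : G.Walk x x) : Prop :=
  IsObstruction c d p ∧ monomial (edgePart p true) (1 : K) - monomial (edgePart p false) 1 ∉
    sfCircuits K (edgeMatrix G)

variable {K}

/-- A rotation may change the sign of the binomial, and squarefree circuits are stable under
negation. -/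
theorem IsNonSfObstruction.rotate {p : G.Walk x y} {q : G.Walk y x}
    (h : IsNonSfObstruction K c d (p.append q)) : IsNonSfObstruction K c d (q.append p) := by
  refine ⟨h.1.rotate, fun hq => h.2 ?_⟩
  have hl := h.1.1
  rw [Walk.length_append] at hl
  by_cases hp : Even p.length
  · have hq' : Even q.length := by grind
    rw [edgePart_append_even _ hp, edgePart_append_even _ hp]
    rwa [edgePart_append_even _ hq', edgePart_append_even _ hq', add_comm,
      add_comm (edgePart q false)] at hq
  · have hp : Odd p.length := Nat.not_even_iff_odd.1 hp
    have hq' : Odd q.length := by grind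
    rw [edgePart_append_odd _ hp, edgePart_append_odd _ hp]
    rw [edgePart_append_odd _ hq', edgePart_append_odd _ hq', add_comm,
      add_comm (edgePart q false)] at hq
    simpa using neg_mem_sfCircuits hq

theorem IsNonSfObstruction.odd_of_append (hc : RelatesBelow c d) {p q : G.Walk x x}
    (h : IsNonSfObstruction K c d (p.append q)) (hp : p.length ≠ 0) (hq : q.length ≠ 0) :
    Odd p.length := by
  by_contra ho
  have := h.1.length_eq_zero_of_even hc (Nat.not_odd_iff_even.1 ho)
  omega

theorem IsNonSfObstruction.exists_odd_append (hc : RelatesBelow c d) {p : G.Walk x x}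
    (h : IsNonSfObstruction K c d p) :
    ∃ (z : V) (q r : G.Walk z z), Odd q.length ∧ IsNonSfObstruction K c d (q.append r) := by
  have hcyc : ¬ p.IsCycle := fun hcyc =>
    h.2 (sfCircuits_of_isCycle K hcyc (by rw [h.1.1]; exact even_two_mul d))
  obtain ⟨z, p₁, p₂, p₃, rfl, hp₁, hp₂⟩ := exists_append_of_not_isCycle hcyc h.1.three_le_length
  have h' := h.rotate
  rw [← Walk.append_assoc] at h'
  exact ⟨z, p₂, _, h'.odd_of_append hc hp₂ (by rw [Walk.length_append]; omega), h'⟩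

/-- A shortest odd closed subwalk is a cycle: a proper closed part of it is again odd by
`odd_of_append`. -/
theorem IsNonSfObstruction.exists_isOddCycle_append (hc : RelatesBelow c d) {p : G.Walk x x}
    (h : IsNonSfObstruction K c d p) :
    ∃ (z : V) (q r : G.Walk z z), IsOddCycle q ∧ IsNonSfObstruction K c d (q.append r) := by
  classical
  have hex : ∃ (n : ℕ) (z : V) (q r : G.Walk z z), Odd q.length ∧
      IsNonSfObstruction K c d (q.append r) ∧ q.length = n := by
    obtain ⟨z, q, r, h1, h2⟩ := h.exists_odd_append hc
    exact ⟨_, z, q, r, h1, h2, rfl⟩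
  obtain ⟨z, q, r, h1, h2, h3⟩ := Nat.find_spec hex
  refine ⟨z, q, r, ⟨?_, h1⟩, h2⟩
  by_contra hcyc
  obtain ⟨w, p₁, p₂, p₃, rfl, hp₁, hp₂⟩ :=
    exists_append_of_not_isCycle hcyc (Walk.three_le_length_of_odd h1)
  have h' : IsNonSfObstruction K c d (p₂.append ((p₃.append r).append p₁)) := by
    rw [← Walk.append_assoc] at h2
    have := h2.rotate
    rwa [← Walk.append_assoc, ← Walk.append_assoc, Walk.append_assoc p₃] at this
  have := Nat.find_min' hex ⟨w, p₂, _, h'.odd_of_append hc hp₂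
    (by simp only [Walk.length_append]; omega), h', rfl⟩
  simp only [Walk.length_append] at h3
  omega

theorem IsNonSfObstruction.exists_two_isOddCycle (hc : RelatesBelow c d) {p : G.Walk x x}
    (h : IsNonSfObstruction K c d p) :
    ∃ (a b : V) (c₁ : G.Walk a a) (p₁ : G.Walk a b) (c₂ : G.Walk b b) (p₂ : G.Walk b a),
      IsOddCycle c₁ ∧ IsOddCycle c₂ ∧
      IsNonSfObstruction K c d (c₁.append (p₁.append (c₂.append p₂))) := by
  classical
  obtain ⟨a, c₁, r, hc₁, hr⟩ := h.exists_isOddCycle_append hc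
  have hex : ∃ (n : ℕ) (b : V) (p₁ : G.Walk a b) (c₂ : G.Walk b b) (p₂ : G.Walk b a),
      Odd c₂.length ∧ IsNonSfObstruction K c d (c₁.append (p₁.append (c₂.append p₂))) ∧
      c₂.length = n := by
    -- The complement of `c₁` is itself an odd closed walk, which starts the search for a shortest
    -- one.
    refine ⟨_, a, .nil, r, .nil, ?_, by simpa using hr, rfl⟩
    have h1 := hr.1.1
    have h2 := hc₁.2
    rw [Walk.length_append] at h1
    grind
  obtain ⟨b, p₁, c₂, p₂, h1, h2, h3⟩ := Nat.find_spec hex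
  refine ⟨a, b, c₁, p₁, c₂, p₂, hc₁, ⟨?_, h1⟩, h2⟩
  by_contra hcyc
  obtain ⟨w, q₁, q₂, q₃, rfl, hq₁, hq₂⟩ :=
    exists_append_of_not_isCycle hcyc (Walk.three_le_length_of_odd h1)
  have h' : IsNonSfObstruction K c d
      (c₁.append ((p₁.append q₁).append (q₂.append (q₃.append p₂)))) := by
    simpa only [← Walk.append_assoc] using h2
  have h'' : IsNonSfObstruction K c d
      (q₂.append ((q₃.append p₂).append (c₁.append (p₁.append q₁)))) := by
    rw [Walk.append_assoc] at h'
    have := h'.rotate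
    rwa [← Walk.append_assoc] at this
  have := Nat.find_min' hex ⟨w, _, q₂, _, h''.odd_of_append hc hq₂
    (by simp only [Walk.length_append]; omega), h', rfl⟩
  simp only [Walk.length_append] at h3
  omega

theorem IsNonSfObstruction.separated (hc : RelatesBelow c d) {q r : G.Walk a a}
    (h : IsNonSfObstruction K c d (q.append r)) (hq : Odd q.length) :
    ∀ x ∈ q.support, x ≠ a → ∀ y ∈ r.support, y ≠ a → ¬ G.Adj x y ∧ x ≠ y := by
  intro x hx hxa y hy hya
  obtain ⟨q₁, q₂, rfl⟩ := Walk.mem_support_iff_exists_append.1 hx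
  obtain ⟨r₁, r₂, rfl⟩ := Walk.mem_support_iff_exists_append.1 hy
  rw [Walk.length_append] at hq
  exact h.1.not_adj hc (fun h0 => hxa (Walk.eq_of_length_eq_zero h0).symm)
    (fun h0 => hxa (Walk.eq_of_length_eq_zero h0))
    (fun h0 => hya (Walk.eq_of_length_eq_zero h0).symm)
    (fun h0 => hya (Walk.eq_of_length_eq_zero h0)) hq

/-- If `a = b`, both connecting walks are trivial; if `a` and `b` are adjacent, both are that edge.
The walk would then be a dumbbell with path length at most 1, a squarefree circuit. So `a` and `b`
are distinct and nonadjacent, and the separation of the two cycles from the rest applies. -/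
theorem IsNonSfObstruction.hasInducedLongDumbbell (hc : RelatesBelow c d) {p : G.Walk x x}
    (h : IsNonSfObstruction K c d p) : HasInducedLongDumbbell G := by
  obtain ⟨a, b, c₁, p₁, c₂, p₂, hc₁, hc₂, hO⟩ := h.exists_two_isOddCycle hc
  clear h p
  have hl₁ := hc₁.1.three_le_length
  have hl₂ := hc₂.1.three_le_length
  have hO₂ : IsNonSfObstruction K c d (c₂.append (p₂.append (c₁.append p₁))) := by
    rw [Walk.append_assoc] at hO
    have := hO.rotate
    rwa [← Walk.append_assoc] at this
  have hO₃ : IsNonSfObstruction K c d (p₁.append (c₂.append (p₂.append c₁))) := by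
    have := hO.rotate
    rwa [← Walk.append_assoc, ← Walk.append_assoc] at this
  have hO₄ : IsNonSfObstruction K c d (p₂.append (c₁.append (p₁.append c₂))) := by
    have := hO₂.rotate
    rwa [← Walk.append_assoc, ← Walk.append_assoc] at this
  have hO₅ : IsNonSfObstruction K c d ((c₁.append p₁).append (c₂.append p₂)) := by
    rwa [Walk.append_assoc] at hO
  have hpar : Odd p₁.length ↔ Odd p₂.length := by
    have h1 := hO.1.1
    have h2 := hc₁.2
    have h3 := hc₂.2
    simp only [Walk.length_append] at h1
    grind
  have sep₁ := hO.separated hc hc₁.2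
  have sep₂ := hO₂.separated hc hc₂.2
  simp only [Walk.mem_support_append_iff] at sep₁ sep₂
  have hD : p₁.IsPath → IsDumbbell c₁ p₁ c₂ := by
    refine fun hp => ⟨hc₁, hc₂, hp, fun z hz hz' => ⟨?_, ?_⟩, fun z hz hz' => ?_,
      fun z hz hz' => ?_⟩ <;> by_contra hne
    · exact (sep₁ z hz hne z (by tauto) hne).2 rfl
    · exact (sep₂ z hz' hne z (by tauto) hne).2 rfl
    · exact (sep₁ z hz' hne z (by tauto) hne).2 rfl
    · exact (sep₂ z hz' hne z (by tauto) hne).2 rfl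
  by_cases hab : a = b
  · subst hab
    by_cases ho : Odd p₁.length
    · have := hO₅.1.length_eq_zero_of_even hc (by rw [Walk.length_append]; exact hc₁.2.add_odd ho)
      simp only [Walk.length_append] at this
      omega
    · have h1 := hO₃.1.length_eq_zero_of_even hc (Nat.not_odd_iff_even.1 ho)
      have h2 := hO₄.1.length_eq_zero_of_even hc (Nat.not_odd_iff_even.1 (mt hpar.2 ho))
      simp only [Walk.length_append] at h1 h2
      have hp₁ : p₁ = .nil := (Walk.length_eq_zero_iff.1 (by omega)).eq_nil
      have hp₂ : p₂ = .nil := (Walk.length_eq_zero_iff.1 (by omega)).eq_nil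
      subst hp₁ hp₂
      refine absurd ((hD .nil).mem_sfCircuits K (by simp)) ?_
      simpa [dumbbellWalk] using hO.2
  by_cases hadj : G.Adj a b
  · by_cases ho : Odd p₁.length
    · have h1 := hO₃.1.length_eq_one_of_adj hc ho hadj
      have h2 := hO₄.1.length_eq_one_of_adj hc (hpar.1 ho) hadj.symm
      simp only [Walk.length_append] at h1 h2
      have hp₁ : p₁.length = 1 := by omega
      have hp₂ := eq_reverse_of_length_eq_one hp₁ (show p₂.length = 1 by omega)
      subst hp₂
      have hpath : p₁.IsPath := by
        cases p₁ with
        | nil => simp at hp₁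
        | cons h q =>
          cases q with
          | nil => simp [h.ne]
          | cons h' q => simp at hp₁
      exact absurd ((hD hpath).mem_sfCircuits K hp₁.le) hO₅.2
    · have := hO₅.1.length_eq_one_of_adj hc (by
        rw [Walk.length_append]; exact hc₁.2.add_even (Nat.not_odd_iff_even.1 ho)) hadj
      simp only [Walk.length_append] at this
      omega
  · exact hasInducedLongDumbbell_of_separated (T₁ := {z | z ∈ c₁.support})
      (T₂ := {z | z ∈ c₂.support}) (P := {z | z ∈ p₁.support}) hc₁.2 hc₂.2 (fun _ h => h)
      (fun _ h => h) (fun _ h => h)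
      (fun z hz hza w hw hwa => sep₁ z hz hza w (hw.elim Or.inl (fun h => Or.inr (Or.inl h))) hwa)
      (fun z hz hzb w hw hwb => sep₂ z hz hzb w
        (hw.elim (fun h => Or.inr (Or.inr h)) (fun h => Or.inr (Or.inl h))) hwb) hab hadj

theorem RelatesBelow.rel_or_mem_sfCircuits (hG : ¬ HasInducedLongDumbbell G)
    (hc : RelatesBelow c d) {u v : G.edgeSet →₀ ℕ}
    (huv : multidegree (edgeMatrix G) u = multidegree (edgeMatrix G) v) (hu : u.degree = d) :
    c u v ∨ monomial u (1 : K) - monomial v 1 ∈ sfCircuits K (edgeMatrix G) := by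
  by_contra! hcon
  obtain ⟨x, p, hp, rfl, rfl⟩ := hc.exists_isObstruction huv hu hcon.1
  exact hG (IsNonSfObstruction.hasInducedLongDumbbell hc ⟨hp, hcon.2⟩)

end Core

/-! ### The congruence of an ideal and the odd cycle condition -/

section Congruence

variable {σ K : Type*} [Field K]

/-- The congruence on exponent vectors which an ideal defines. -/
def idealCon (J : Ideal (MvPolynomial σ K)) : AddCon (σ →₀ ℕ) where
  r u v := monomial u 1 - monomial v 1 ∈ J
  iseqv := by
    refine ⟨fun u => by simp, fun {u v} h => ?_, fun {u v w} h h' => ?_⟩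
    · rw [← neg_sub]; exact neg_mem h
    · rw [← sub_add_sub_cancel]; exact add_mem h h'
  add' := by
    intro u v u' v' h h'
    have hm : ∀ a b : σ →₀ ℕ, monomial (a + b) (1 : K) = monomial a 1 * monomial b 1 := by
      intro a b; rw [monomial_mul, one_mul]
    have : monomial (u + u') (1 : K) - monomial (v + v') 1 =
        monomial u' 1 * (monomial u 1 - monomial v 1) +
          monomial v 1 * (monomial u' 1 - monomial v' 1) := by
      rw [hm, hm]; ring
    change monomial (u + u') (1 : K) - monomial (v + v') 1 ∈ J
    rw [this]
    exact add_mem (J.mul_mem_left _ h) (J.mul_mem_left _ h')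

end Congruence

/-- By inducedness the edge joining the cycles belongs to the dumbbell, hence to `p`; it then joins
the ends of `p`, so `p` has length 1. -/
theorem OddCycleCondition.not_hasInducedLongDumbbell {V : Type*} {G : SimpleGraph V}
    (h : OddCycleCondition G) :
    ¬ HasInducedLongDumbbell G := by
  rintro ⟨a, b, c₁, c₂, p, h1, h2, hp, hp2, h12, hp1, hpc, hind⟩
  obtain ⟨x, hx, y, hy, hxy⟩ := h a b c₁ c₂ h1 h2 h12
  have hadj := hind (v := x) (by simp [hx]) (w := y) (by simp [hy]) hxy
  simp only [Subgraph.sup_adj, Walk.adj_toSubgraph_iff_mem_edges] at hadj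
  rcases hadj with (hadj | hadj) | hadj
  · exact h12 y (c₁.snd_mem_support_of_mem_edges hadj) hy
  · have hxa := hp1 x (p.fst_mem_support_of_mem_edges hadj) hx
    have hyb := hpc y (p.snd_mem_support_of_mem_edges hadj) hy
    subst hxa hyb
    have := hp.length_eq_one_of_mem_edges hadj
    omega
  · exact h12 x hx (c₂.fst_mem_support_of_mem_edges hadj)

/-! ### Generation by squarefree circuits and redundancy of the others -/

section Main

variable {V : Type*} [Fintype V] {G : SimpleGraph V} (K : Type*) [Field K]

theorem toricIdeal_eq_span_sfCircuits (hG : ¬ HasInducedLongDumbbell G) :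
    toricIdeal K (edgeMatrix G) = Ideal.span (sfCircuits K (edgeMatrix G)) := by
  have hrel : ∀ d, RelatesBelow (idealCon (Ideal.span (sfCircuits K (edgeMatrix G)))) d := by
    intro d
    induction d with
    | zero => intro u v _ h; omega
    | succ d ih =>
      intro u v huv hd
      rcases (Nat.lt_succ_iff_lt_or_eq.1 hd) with h | h
      · exact ih u v huv h
      · rcases ih.rel_or_mem_sfCircuits (K := K) hG huv h with h' | h'
        · exact h'
        · exact Ideal.subset_span h'
  refine le_antisymm (toricIdeal_le_of_binomials_mem fun u v huv =>
    hrel _ u v huv (Nat.lt_succ_self _)) (Ideal.span_le.2 fun f hf => hf.1.1)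

theorem isRedundant_of_notMem_sfCircuits (hG : ¬ HasInducedLongDumbbell G)
    {f : MvPolynomial G.edgeSet K} (hf : f ∈ circuits K (edgeMatrix G))
    (hsf : f ∉ sfCircuits K (edgeMatrix G)) : IsRedundant (edgeMatrix G) f := by
  obtain ⟨hI, ⟨u, v, huv, rfl⟩, -⟩ := hf
  have hm := binomial_mem_toricIdeal_iff.1 hI
  refine isRedundant_of_mem_span_lower isGraded_edgeMatrix rfl (isGraded_edgeMatrix _ _ hm).symm ?_
  -- For this ideal `RelatesBelow` holds by construction, and being related means lying in the span
  -- of lower degree.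
  set J := Ideal.span {g : MvPolynomial G.edgeSet K | ∃ a b : G.edgeSet →₀ ℕ,
    multidegree (edgeMatrix G) a = multidegree (edgeMatrix G) b ∧ a.degree < u.degree ∧
      g = monomial a 1 - monomial b 1}
  have hrel : RelatesBelow (idealCon J) u.degree := fun a b hab hd =>
    Ideal.subset_span ⟨a, b, hab, hd, rfl⟩
  exact (hrel.rel_or_mem_sfCircuits (K := K) hG hm rfl).resolve_right hsf

end Main

end

end ToricCircuits

theorem theorem2p4 {V : Type*} [Fintype V] (K : Type*) [Field K]
    (G : SimpleGraph V) (hG : G.Connected) :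
    List.TFAE [
      ToricCircuits.toricIdeal K (ToricCircuits.edgeMatrix G) =
        Ideal.span (ToricCircuits.sfCircuits K (ToricCircuits.edgeMatrix G)),
      ∀ f ∈ ToricCircuits.circuits K (ToricCircuits.edgeMatrix G) \
          ToricCircuits.sfCircuits K (ToricCircuits.edgeMatrix G),
        ToricCircuits.IsRedundant (ToricCircuits.edgeMatrix G) f,
      ∀ f ∈ ToricCircuits.circuits K (ToricCircuits.edgeMatrix G) \
          ToricCircuits.sfCircuits K (ToricCircuits.edgeMatrix G),
        ¬ ToricCircuits.IsIndispensable (ToricCircuits.edgeMatrix G) f,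
      ∀ f ∈ ToricCircuits.circuits K (ToricCircuits.edgeMatrix G) \
          ToricCircuits.sfCircuits K (ToricCircuits.edgeMatrix G),
        ¬ ToricCircuits.IsFundamental (ToricCircuits.edgeMatrix G) f,
      ¬ ToricCircuits.HasInducedLongDumbbell G] ∧
    (ToricCircuits.OddCycleCondition G → ¬ ToricCircuits.HasInducedLongDumbbell G) := by
  refine ⟨?_, fun h => h.not_hasInducedLongDumbbell⟩
  tfae_have 5 → 1 := ToricCircuits.toricIdeal_eq_span_sfCircuits K
  tfae_have 5 → 2 := fun h f hf => ToricCircuits.isRedundant_of_notMem_sfCircuits K h hf.1 hf.2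
  tfae_have 1 → 3 := fun h f hf => ToricCircuits.not_isIndispensable_of_span_sfCircuits h hf.2
  tfae_have 2 → 3 := fun h f hf hind => hind.not_isRedundant (h f hf)
  tfae_have 3 → 4 := fun h f hf hfund =>
    h f hf (hfund.isIndispensable ToricCircuits.isGraded_edgeMatrix)
  tfae_have 4 → 5 := by
    intro h hG
    obtain ⟨f, hf, hfund⟩ := hG.exists_isFundamental K
    exact h f hf hfund
  tfae_finish
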